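/- Let $R$ be a discrete valuation ring with fraction field of characteristic $0$ and residue field of characteristic $p>0$, let $v$ be its normalized valuation, $\pi$ a uniformizer, and $n\ge 1$ an integer. For $\lambda\in R$ with $v(p)\ge p^{n-1}(p-1)v(\lambda)$ (which forces $\lambda\ne 0$), let $\mathcal G^{(\lambda)}=\mathrm{Spec}\,R[T,\tfrac1{1+\lambda T}]$ be the $R$-group scheme with group law $(s,t)\mapsto s+t+\lambda st$, and let $$G_{\lambda,n}=\ker\Big(\psi_{\lambda,n}\colon\mathcal G^{(\lambda)}\to\mathcal G^{(\lambda^{p^n})},\quad t\mapsto \tfrac{(1+\lambda t)^{p^n}-1}{\lambda^{p^n}}\Big),$$ a finite flat commutative $R$-group scheme of order $p^n$. Let $\alpha^{\lambda,n}\colon G_{\lambda,n}\to\mu_{p^n}$ be the homomorphism $t\mapsto 1+\lambda t$, and, if moreover $\lambda=c\mu$ with $c,\mu\in R$ and $v(p)\ge p^{n-1}(p-1)v(\mu)$, let $G_{\lambda,n}\to G_{\mu,n}$ be the homomorphism $t\mapsto ct=\tfrac{\lambda}{\mu}t$. Let $X$ be a normal integral faithfully flat $R$-scheme; cohomology is taken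 in the fppf topology. Then $i_0=\max\{i\ge 0 : v(p)\ge p^{n-1}(p-1)\,v(\pi^i)\}$ exists, every $i\le i_0$ satisfies $v(p)\ge p^{n-1}(p-1)v(\pi^i)$, and: 1. for every $0\le i\le i_0$ the map $(\alpha^{\pi^i,n})_*\colon H^1(X,G_{\pi^i,n})\to H^1(X,\mu_{p^n})$ is injective; 2. for all $0\le j\le i\le i_0$ the map $H^1(X,G_{\pi^i,n})\to H^1(X,G_{\pi^j,n})$ induced by $t\mapsto \pi^{i-j}t$ is injective, its composite with $(\alpha^{\pi^j,n})_*$ is $(\alpha^{\pi^i,n})_*$, and hence the image of $(\alpha^{\pi^i,n})_*$ is contained in that of $(\alpha^{\pi^j,n})_*$. Thus, identifying these groups with their images in $H^1(X,\mu_{p^n})$, one has the filtration $$0\subseteq H^1(X,G_{\pi^{i_0},n})\subseteq H^1(X,G_{\pi^{i_0-1},n})\subseteq\dots\subseteq H^1(X,G_{\pi,n})\subseteq H^1(X,\mu_{p^n}).$$ -/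

import Mathlib

open CategoryTheory AlgebraicGeometry Opposite Polynomial

universe u

namespace FppfFiltration

/-! ### The groups `𝒢^(l)(B) = {t ∈ B | 1 + l t ∈ Bˣ}` -/

/-- The `B`-points of the group scheme `𝒢^(l) = Spec B[T, 1/(1 + lT)]`, for `l ∈ B`: the elements
`t` of `B` with `1 + l t` invertible. -/
@[ext]
structure GPoint {B : Type*} [CommRing B] (l : B) where
  val : B
  isUnit : IsUnit (1 + l * val)

namespace GPoint

variable {B B' : Type*} [CommRing B] [CommRing B']

instance (l : B) : One (GPoint l) := ⟨⟨0, by simp⟩⟩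

instance (l : B) : Mul (GPoint l) :=
  ⟨fun x y => ⟨x.val + y.val + l * x.val * y.val, by
    have h := x.isUnit.mul y.isUnit
    have e : 1 + l * (x.val + y.val + l * x.val * y.val) = (1 + l * x.val) * (1 + l * y.val) := by
      ring
    rwa [e]⟩⟩

theorem inv_aux {l : B} (x : GPoint l) :
    (1 + l * x.val) * (1 + l * (-x.val * (↑x.isUnit.unit⁻¹ : B))) = 1 := by
  have h : (1 + l * x.val) * (↑x.isUnit.unit⁻¹ : B) = 1 := x.isUnit.mul_val_inv
  linear_combination (-(l * x.val)) * h

/-- The inverse is `-t / (1 + l t)`. -/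
noncomputable instance (l : B) : Inv (GPoint l) :=
  ⟨fun x => ⟨-x.val * (↑x.isUnit.unit⁻¹ : B), IsUnit.of_mul_eq_one_right _ (inv_aux x)⟩⟩

@[simp] theorem val_one (l : B) : (1 : GPoint l).val = 0 := rfl

@[simp] theorem val_mul {l : B} (x y : GPoint l) :
    (x * y).val = x.val + y.val + l * x.val * y.val := rfl

theorem val_inv {l : B} (x : GPoint l) : (x⁻¹).val = -x.val * (↑x.isUnit.unit⁻¹ : B) := rfl

noncomputable instance (l : B) : CommGroup (GPoint l) where
  mul_assoc x y z := by ext; simp; ring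
  one_mul x := by ext; simp
  mul_one x := by ext; simp
  mul_comm x y := by ext; simp; ring
  inv_mul_cancel x := by
    ext
    have h : (1 + l * x.val) * (↑x.isUnit.unit⁻¹ : B) = 1 := x.isUnit.mul_val_inv
    simp only [val_mul, val_inv, val_one]
    linear_combination (-x.val) * h

/-- The morphism `α^l : 𝒢^(l) → 𝔾ₘ`, `t ↦ 1 + l t`. -/
noncomputable def alpha (l : B) : GPoint l →* Bˣ where
  toFun x := x.isUnit.unit
  map_one' := by ext; simp
  map_mul' x y := by ext; simp; ring

@[simp] theorem coe_alpha {l : B} (x : GPoint l) : (alpha l x : B) = 1 + l * x.val := rfl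

/-- Functoriality of the points in the ring. -/
def map (g : B →+* B') {l : B} {l' : B'} (h : g l = l') : GPoint l →* GPoint l' where
  toFun x := ⟨g x.val, by simpa [h] using x.isUnit.map g⟩
  map_one' := by ext; simp
  map_mul' x y := by ext; simp [h]

@[simp] theorem val_map (g : B →+* B') {l : B} {l' : B'} (h : g l = l') (x : GPoint l) :
    (map g h x).val = g x.val := rfl

/-- The morphism `𝒢^(l) → 𝒢^(m)`, `t ↦ (l / m) t`, where `l = c m`. -/
def scale {l m : B} (c : B) (h : l = c * m) : GPoint l →* GPoint m where
  toFun x := ⟨c * x.val, by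
    have e : 1 + m * (c * x.val) = 1 + l * x.val := by linear_combination (-x.val) * h
    rw [e]; exact x.isUnit⟩
  map_one' := by ext; simp
  map_mul' x y := by ext; simp [h]; ring

@[simp] theorem val_scale {l m : B} (c : B) (h : l = c * m) (x : GPoint l) :
    (scale c h x).val = c * x.val := rfl

end GPoint

/-! ### The isogeny `ψ_{a,n}` and its kernel -/

section Isogeny

variable {R : Type*} [CommRing R] [IsDomain R]

open Classical in
/-- The polynomial `((1 + a T)^q - 1) / a^q`, whenever it has coefficients in `R` (and `0`
otherwise). -/
noncomputable def isogenyPoly (a : R) (q : ℕ) : R[X] :=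
  if h : ∃ P : R[X], C (a ^ q) * P = (1 + C a * X) ^ q - 1 then h.choose else 0

/-- The condition `v(p) ≥ p^(n-1) (p-1) v(a)`, with `v` the normalized valuation of `R`. -/
def Admissible [IsDiscreteValuationRing R] (p n : ℕ) (a : R) : Prop :=
  (p ^ (n - 1) * (p - 1)) • IsDiscreteValuationRing.addVal R a ≤
    IsDiscreteValuationRing.addVal R (p : R)

theorem Admissible.ne_zero [IsDiscreteValuationRing R] [CharZero R] {p n : ℕ} [hp : Fact p.Prime]
    {a : R} (h : Admissible p n a) : a ≠ 0 := by
  rintro rfl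
  have h2 := hp.out.two_le
  have h1 : p ^ (n - 1) * (p - 1) ≠ 0 :=
    mul_ne_zero (pow_ne_zero _ (by omega)) (by omega)
  rw [Admissible, ← IsDiscreteValuationRing.addVal_pow, zero_pow h1,
    IsDiscreteValuationRing.addVal_le_iff_dvd, zero_dvd_iff, Nat.cast_eq_zero] at h
  omega

theorem Admissible.dvd [IsDiscreteValuationRing R] {p n : ℕ} {a : R} (h : Admissible p n a) :
    a ^ (p ^ (n - 1) * (p - 1)) ∣ (p : R) := by
  rwa [Admissible, ← IsDiscreteValuationRing.addVal_pow,
    IsDiscreteValuationRing.addVal_le_iff_dvd] at h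

theorem pow_dvd_one_add_mul_pow_sub_one {S : Type*} [CommRing S] {p : ℕ} (hp : p.Prime) (b Q : S)
    (h : b ^ (p - 1) ∣ (p : S)) : b ^ p ∣ (1 + b * Q) ^ p - 1 := by
  rw [add_comm, add_pow, Finset.sum_range_succ']
  simp only [one_pow, mul_one, pow_zero, Nat.choose_zero_right, Nat.cast_one,
    add_sub_cancel_right]
  refine Finset.dvd_sum fun k hk => ?_
  rw [Finset.mem_range] at hk
  rw [mul_pow]
  rcases Nat.lt_or_ge (k + 1) p with hlt | hge
  · have h1 : (p : S) ∣ (p.choose (k + 1) : S) :=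
      Nat.cast_dvd_cast (hp.dvd_choose_self (by omega) hlt)
    have h2 : b ^ p ∣ b ^ (k + 1) * (p.choose (k + 1) : S) := by
      calc b ^ p ∣ b ^ (k + 1) * b ^ (p - 1) := by
            rw [← pow_add]; exact pow_dvd_pow _ (by omega)
        _ ∣ _ := mul_dvd_mul_left _ (h.trans h1)
    rw [mul_right_comm]
    exact h2.mul_right _
  · have : k + 1 = p := by omega
    rw [this, mul_assoc]
    exact dvd_mul_right _ _

theorem exists_isogenyPoly [IsDiscreteValuationRing R] {p n : ℕ} (hp : p.Prime) {a : R}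
    (h : Admissible p n a) :
    ∃ P : R[X], C (a ^ p ^ n) * P = (1 + C a * X) ^ p ^ n - 1 := by
  have key : ∀ m ≤ n, C a ^ p ^ m ∣ (1 + C a * X) ^ p ^ m - 1 := by
    intro m
    induction m with
    | zero => intro _; simp
    | succ m ih =>
      intro hm
      obtain ⟨Q, hQ⟩ := ih (by omega)
      have e : (1 + C a * X) ^ p ^ m = 1 + C a ^ p ^ m * Q := by rw [← hQ]; ring
      rw [pow_succ, pow_mul, pow_mul, e]
      apply pow_dvd_one_add_mul_pow_sub_one hp
      have h1 : a ^ (p ^ m * (p - 1)) ∣ (p : R) :=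
        (pow_dvd_pow a (Nat.mul_le_mul_right _ (Nat.pow_le_pow_right hp.pos (by omega)))).trans
          h.dvd
      have h2 := map_dvd (C : R →+* R[X]) h1
      simpa [pow_mul] using h2
  obtain ⟨P, hP⟩ := key n le_rfl
  exact ⟨P, by rw [hP, C_pow]⟩

theorem isogenyPoly_spec [IsDiscreteValuationRing R] {p n : ℕ} [hp : Fact p.Prime] {a : R}
    (h : Admissible p n a) :
    C (a ^ p ^ n) * isogenyPoly a (p ^ n) = (1 + C a * X) ^ p ^ n - 1 := by
  have hex := exists_isogenyPoly hp.out h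
  rw [isogenyPoly, dif_pos hex]
  exact hex.choose_spec

theorem eval₂_isogenyPoly [IsDiscreteValuationRing R] {p n : ℕ} [Fact p.Prime] {a : R}
    (h : Admissible p n a) {B : Type*} [CommRing B] (φ : R →+* B) (t : B) :
    φ a ^ p ^ n * (isogenyPoly a (p ^ n)).eval₂ φ t = (1 + φ a * t) ^ p ^ n - 1 := by
  have := congrArg (Polynomial.eval₂ φ t) (isogenyPoly_spec h)
  simpa [eval₂_mul, eval₂_sub, eval₂_add, eval₂_pow] using this

theorem eval₂_isogenyPoly_mul [IsDiscreteValuationRing R] [CharZero R] {p n : ℕ} [Fact p.Prime]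
    {a : R} (h : Admissible p n a) {B : Type*} [CommRing B] (φ : R →+* B) (x y : B) :
    (isogenyPoly a (p ^ n)).eval₂ φ (x + y + φ a * x * y) =
      (isogenyPoly a (p ^ n)).eval₂ φ x + (isogenyPoly a (p ^ n)).eval₂ φ y +
        φ a ^ p ^ n * (isogenyPoly a (p ^ n)).eval₂ φ x * (isogenyPoly a (p ^ n)).eval₂ φ y := by
  set P := isogenyPoly a (p ^ n) with hP
  let ι : R →+* R[X][X] := C.comp C
  have univ : P.eval₂ ι (C X + X + ι a * C X * X) =
      P.eval₂ ι (C X) + P.eval₂ ι X + ι a ^ p ^ n * P.eval₂ ι (C X) * P.eval₂ ι X := by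
    have hne : ι a ^ p ^ n ≠ 0 := by
      refine pow_ne_zero _ fun h0 => h.ne_zero ?_
      exact C_injective (C_injective (by simpa [ι] using h0))
    apply mul_left_cancel₀ hne
    have e1 := eval₂_isogenyPoly h ι (C X + X + ι a * C X * X)
    have e2 := eval₂_isogenyPoly h ι (C X)
    have e3 := eval₂_isogenyPoly h ι X
    rw [← hP] at e1 e2 e3
    have e4 : (1 + ι a * (C X + X + ι a * C X * X)) ^ p ^ n =
        (1 + ι a * C X) ^ p ^ n * (1 + ι a * X) ^ p ^ n := by
      rw [← mul_pow]; congr 1; ring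
    rw [e4] at e1
    linear_combination e1 - e2 - e3 - (ι a ^ p ^ n * P.eval₂ ι X) * e2 -
      ((1 + ι a * C X) ^ p ^ n - 1) * e3
  let ev : R[X][X] →+* B := eval₂RingHom (eval₂RingHom φ x) y
  have hev : ev.comp ι = φ := by ext r; simp [ev, ι]
  have hx : ev (C X) = x := by simp [ev]
  have hy : ev X = y := by simp [ev]
  have ha : ev (ι a) = φ a := by rw [← hev]; rfl
  have := congrArg ev univ
  simpa only [map_add, map_mul, map_pow, hom_eval₂, hev, hx, hy, ha] using this

/-- The isogeny `ψ_{a,n} : 𝒢^(a) → 𝒢^(a^(p^n))`, `t ↦ ((1 + a t)^(p^n) - 1) / a^(p^n)`, on the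
points with values in an `R`-algebra `φ : R → B`. -/
noncomputable def isogeny [IsDiscreteValuationRing R] [CharZero R] {p n : ℕ} [Fact p.Prime] {a : R}
    (h : Admissible p n a) {B : Type*} [CommRing B] (φ : R →+* B) :
    GPoint (φ a) →* GPoint (φ a ^ p ^ n) where
  toFun x := ⟨(isogenyPoly a (p ^ n)).eval₂ φ x.val, by
    rw [eval₂_isogenyPoly h, add_sub_cancel]; exact x.isUnit.pow _⟩
  map_one' := by
    ext
    have e : ∀ (Q : R[X]), Q.eval₂ φ 0 = φ (Q.coeff 0) := fun Q => by
      rw [eval₂_at_zero]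
    have h0 : (isogenyPoly a (p ^ n)).coeff 0 = 0 := by
      have := congrArg (fun Q : R[X] => Q.coeff 0) (isogenyPoly_spec h)
      simp [coeff_zero_eq_eval_zero] at this
      rw [coeff_zero_eq_eval_zero]
      exact this.resolve_left fun h' => h.ne_zero h'.1
    simp [e, h0]
  map_mul' x y := by
    ext
    simp [eval₂_isogenyPoly_mul h]

@[simp] theorem val_isogeny [IsDiscreteValuationRing R] [CharZero R] {p n : ℕ} [Fact p.Prime]
    {a : R} (h : Admissible p n a) {B : Type*} [CommRing B] (φ : R →+* B) (x : GPoint (φ a)) :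
    (isogeny h φ x).val = (isogenyPoly a (p ^ n)).eval₂ φ x.val := rfl

/-- The group `G_{a,n}(B)`, the kernel of `ψ_{a,n}` on `B`-points. -/
noncomputable abbrev kerPoints [IsDiscreteValuationRing R] [CharZero R] {p n : ℕ} [Fact p.Prime]
    {a : R} (h : Admissible p n a) {B : Type*} [CommRing B] (φ : R →+* B) :
    Subgroup (GPoint (φ a)) :=
  (isogeny h φ).ker

theorem mem_kerPoints_iff [IsDiscreteValuationRing R] [CharZero R] {p n : ℕ} [Fact p.Prime]
    {a : R} (h : Admissible p n a) {B : Type*} [CommRing B] (φ : R →+* B) (x : GPoint (φ a)) :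
    x ∈ kerPoints h φ ↔ (isogenyPoly a (p ^ n)).eval₂ φ x.val = 0 := by
  rw [MonoidHom.mem_ker, GPoint.ext_iff, val_isogeny, GPoint.val_one]

theorem isUnit_of_eval₂_eq_zero [IsDiscreteValuationRing R] {p n : ℕ} [hp : Fact p.Prime]
    {a : R} (h : Admissible p n a) {B : Type*} [CommRing B] (φ : R →+* B) (t : B)
    (ht : (isogenyPoly a (p ^ n)).eval₂ φ t = 0) : IsUnit (1 + φ a * t) := by
  have e := eval₂_isogenyPoly h φ t
  rw [ht, mul_zero, eq_comm, sub_eq_zero] at e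
  exact IsUnit.of_pow_eq_one e (pow_ne_zero _ hp.out.ne_zero)

/-- The restriction `α^{a,n} : G_{a,n} → μ_{p^n}` of `α^a` to the kernels of `ψ_{a,n}` and of
the `p^n`-th power map. -/
noncomputable def kerAlpha [IsDiscreteValuationRing R] [CharZero R] {p n : ℕ} [Fact p.Prime]
    {a : R} (h : Admissible p n a) {B : Type*} [CommRing B] (φ : R →+* B) :
    kerPoints h φ →* rootsOfUnity (p ^ n) B :=
  ((GPoint.alpha (φ a)).comp (kerPoints h φ).subtype).codRestrict _ fun x => by
    rw [mem_rootsOfUnity']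
    have e := eval₂_isogenyPoly h φ x.1.val
    rw [(mem_kerPoints_iff h φ x.1).1 x.2, mul_zero, eq_comm, sub_eq_zero] at e
    simpa using e

/-- The restriction of a ring homomorphism of `R`-algebras to points of `G_{a,n}`. -/
noncomputable def kerMap [IsDiscreteValuationRing R] [CharZero R] {p n : ℕ} [Fact p.Prime]
    {a : R} (h : Admissible p n a) {B B' : Type*} [CommRing B] [CommRing B'] {φ : R →+* B}
    {φ' : R →+* B'} (g : B →+* B') (hg : g.comp φ = φ') : kerPoints h φ →* kerPoints h φ' :=
  ((GPoint.map g (congrArg (fun χ : R →+* B' => χ a) hg)).comp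
    (kerPoints h φ).subtype).codRestrict _ fun x => by
    have e := (mem_kerPoints_iff h φ x.1).1 x.2
    rw [mem_kerPoints_iff]
    have := congrArg g e
    rwa [hom_eval₂, hg, map_zero] at this

theorem isogenyPoly_scale [IsDiscreteValuationRing R] [CharZero R] {p n : ℕ} [Fact p.Prime]
    {a b c : R} (ha : Admissible p n a) (hb : Admissible p n b) (hc : a = c * b) :
    (isogenyPoly b (p ^ n)).comp (C c * X) = C (c ^ p ^ n) * isogenyPoly a (p ^ n) := by
  have hne : (C (b ^ p ^ n) : R[X]) ≠ 0 := C_ne_zero.2 (pow_ne_zero _ hb.ne_zero)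
  apply mul_left_cancel₀ hne
  have e1 := isogenyPoly_spec ha
  have e2 := congrArg (fun Q : R[X] => Q.comp (C c * X)) (isogenyPoly_spec hb)
  simp only [mul_comp, C_comp, sub_comp, pow_comp, add_comp, one_comp, X_comp] at e2
  have e3 : C (b ^ p ^ n) * C (c ^ p ^ n) = (C (a ^ p ^ n) : R[X]) := by
    rw [← C_mul, hc, mul_pow, mul_comm]
  have e4 : (C b : R[X]) * (C c * X) = C a * X := by
    rw [hc, C_mul]; ring
  rw [e4] at e2
  rw [e2, ← mul_assoc, e3, e1]

/-- The morphism `G_{a,n} → G_{b,n}`, `t ↦ (a / b) t`, where `a = c b`. -/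
noncomputable def kerScale [IsDiscreteValuationRing R] [CharZero R] {p n : ℕ} [Fact p.Prime]
    {a b c : R} (ha : Admissible p n a) (hb : Admissible p n b) (hc : a = c * b)
    {B : Type*} [CommRing B] (φ : R →+* B) : kerPoints ha φ →* kerPoints hb φ :=
  ((GPoint.scale (φ c) (by rw [hc, map_mul])).comp (kerPoints ha φ).subtype).codRestrict _
    fun x => by
    have e := (mem_kerPoints_iff ha φ x.1).1 x.2
    rw [mem_kerPoints_iff]
    have := congrArg (fun Q : R[X] => Q.eval₂ φ x.1.val) (isogenyPoly_scale ha hb hc)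
    simpa [eval₂_comp, e] using this

end Isogeny

/-! ### The sheaves `G_{a,n}` and `μ_q` on the fppf site of `X` -/

section Sheaves

/-- The homomorphism `R → Γ(U, 𝒪_U)` of a scheme `U` over `X`, for an `R`-scheme `f : X → Spec R`. -/
noncomputable def structMap {R : Type u} [CommRing R] {X : Scheme.{u}}
    (f : X ⟶ Spec (CommRingCat.of R)) (U : Over X) : R →+* Γ(U.left, ⊤) :=
  ((Scheme.ΓSpecIso (CommRingCat.of R)).inv ≫ (U.hom ≫ f).appTop).hom

theorem comp_structMap {R : Type u} [CommRing R] {X : Scheme.{u}}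
    (f : X ⟶ Spec (CommRingCat.of R)) {U V : Over X} (g : V ⟶ U) :
    g.left.appTop.hom.comp (structMap f U) = structMap f V := by
  rw [structMap, structMap, ← CommRingCat.hom_comp, Category.assoc, ← Scheme.Hom.comp_appTop,
    Over.w_assoc]

/-- The functor of zeros `U ↦ {t ∈ Γ(U, 𝒪_U) | F(t) = 0}` of a polynomial `F` over `R`. -/
noncomputable def zeroLocus {R : Type u} [CommRing R] {X : Scheme.{u}}
    (f : X ⟶ Spec (CommRingCat.of R)) (F : R[X]) : (Over X)ᵒᵖ ⥤ Type u where
  obj U := {t : Γ(U.unop.left, ⊤) // F.eval₂ (structMap f U.unop) t = 0}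
  map {U V} g := ↾fun t => ⟨g.unop.left.appTop.hom t.1, by
    rw [← comp_structMap f g.unop, ← hom_eval₂, t.2, map_zero]⟩

theorem toSpecΓ_comp_appTop {U : Scheme.{u}} {A : CommRingCat.{u}} (φ : A ⟶ Γ(U, ⊤)) :
    (Scheme.ΓSpecIso A).inv ≫ (U.toSpecΓ ≫ Spec.map φ).appTop = φ := by
  rw [Scheme.Hom.comp_appTop, ← Scheme.ΓSpecIso_inv_naturality_assoc]
  simp

theorem hom_Spec_ext {U : Scheme.{u}} {A : CommRingCat.{u}} {g g' : U ⟶ Spec A}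
    (h : (Scheme.ΓSpecIso A).inv ≫ g.appTop = (Scheme.ΓSpecIso A).inv ≫ g'.appTop) : g = g' :=
  ext_of_isAffine (by simpa using h)

theorem root_of_hom {R : Type u} [CommRing R] {X : Scheme.{u}}
    (f : X ⟶ Spec (CommRingCat.of R)) (F : R[X]) (U : Over X) (g : (Over.map f).obj U ⟶
      Over.mk (Spec.map (CommRingCat.ofHom (algebraMap R (AdjoinRoot F))))) :
    ((Scheme.ΓSpecIso (CommRingCat.of (AdjoinRoot F))).inv ≫ g.left.appTop).hom.comp
      (algebraMap R (AdjoinRoot F)) = structMap f U := by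
  have h := Over.w g
  dsimp at h
  rw [structMap, ← h, Scheme.Hom.comp_appTop, ← Scheme.ΓSpecIso_inv_naturality_assoc]
  rfl

theorem eval₂_root_of_hom {R : Type u} [CommRing R] {X : Scheme.{u}}
    (f : X ⟶ Spec (CommRingCat.of R)) (F : R[X]) (U : Over X) (g : (Over.map f).obj U ⟶
      Over.mk (Spec.map (CommRingCat.ofHom (algebraMap R (AdjoinRoot F))))) :
    F.eval₂ (structMap f U)
      (((Scheme.ΓSpecIso (CommRingCat.of (AdjoinRoot F))).inv ≫ g.left.appTop).hom
        (AdjoinRoot.root F)) = 0 := by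
  have e : F.eval₂ (algebraMap R (AdjoinRoot F)) (AdjoinRoot.root F) = 0 := AdjoinRoot.eval₂_root F
  have h := hom_eval₂ F (algebraMap R (AdjoinRoot F))
    ((Scheme.ΓSpecIso (CommRingCat.of (AdjoinRoot F))).inv ≫ g.left.appTop).hom
    (AdjoinRoot.root F)
  rw [← root_of_hom f F U g]
  exact h.symm.trans ((congrArg _ e).trans (map_zero _))

theorem adjoinRoot_hom_ext {R : Type*} [CommRing R] {F : R[X]} {B : Type*} [CommRing B]
    {g g' : AdjoinRoot F →+* B} (h : g.comp (AdjoinRoot.of F) = g'.comp (AdjoinRoot.of F))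
    (hr : g (AdjoinRoot.root F) = g' (AdjoinRoot.root F)) : g = g' :=
  Ideal.Quotient.ringHom_ext (Polynomial.ringHom_ext' h hr)

/-- The functor of zeros of `F` is represented by the scheme `Spec (R[T] / F)` over `R`. -/
noncomputable def zeroLocusIso {R : Type u} [CommRing R] {X : Scheme.{u}}
    (f : X ⟶ Spec (CommRingCat.of R)) (F : R[X]) :
    zeroLocus f F ≅ (Over.map f).op ⋙ yoneda.obj
      (Over.mk (Spec.map (CommRingCat.ofHom (algebraMap R (AdjoinRoot F))))) :=
  NatIso.ofComponents (fun U => equivEquivIso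
    { toFun := fun t => Over.homMk (U.unop.left.toSpecΓ ≫
        Spec.map (CommRingCat.ofHom (AdjoinRoot.lift (structMap f U.unop) t.1 t.2))) (by
          apply hom_Spec_ext
          change _ ≫ ((U.unop.left.toSpecΓ ≫ Spec.map _) ≫ Spec.map _).appTop =
            _ ≫ (U.unop.hom ≫ f).appTop
          rw [Category.assoc, ← Spec.map_comp, toSpecΓ_comp_appTop, ← CommRingCat.ofHom_comp]
          apply CommRingCat.hom_ext
          change _ = structMap f U.unop
          ext r
          exact AdjoinRoot.lift_of (f := F) t.2)
      invFun := fun g => ⟨((Scheme.ΓSpecIso (CommRingCat.of (AdjoinRoot F))).inv ≫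
        g.left.appTop).hom (AdjoinRoot.root F), eval₂_root_of_hom f F U.unop g⟩
      left_inv := fun t => by
        apply Subtype.ext
        have := congrArg (fun φ => φ.hom (AdjoinRoot.root F)) (toSpecΓ_comp_appTop
          (CommRingCat.ofHom (AdjoinRoot.lift (structMap f U.unop) t.1 t.2)))
        exact this.trans (AdjoinRoot.lift_root (f := F) t.2)
      right_inv := fun g => by
        apply Over.OverMorphism.ext
        apply hom_Spec_ext
        refine (toSpecΓ_comp_appTop _).trans ?_
        apply CommRingCat.hom_ext
        refine adjoinRoot_hom_ext ?_ ?_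
        · ext r
          exact (AdjoinRoot.lift_of (f := F) (eval₂_root_of_hom f F U.unop g)).trans
            (congrArg (fun χ : R →+* _ => χ r) (root_of_hom f F U.unop g)).symm
        · exact AdjoinRoot.lift_root (f := F) (eval₂_root_of_hom f F U.unop g) }) (by
    intro U V g
    ext t
    apply Over.OverMorphism.ext
    apply hom_Spec_ext
    refine (toSpecΓ_comp_appTop _).trans ?_
    change _ = _ ≫ (g.unop.left ≫ (U.unop.left.toSpecΓ ≫ Spec.map _)).appTop
    rw [Scheme.Hom.comp_appTop, ← Category.assoc, toSpecΓ_comp_appTop]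
    apply CommRingCat.hom_ext
    refine adjoinRoot_hom_ext ?_ ?_
    · ext r
      refine (AdjoinRoot.lift_of (f := F) ((zeroLocus f F).map g t).2).trans ?_
      refine (congrArg (fun χ : R →+* _ => χ r) (comp_structMap f g.unop)).symm.trans ?_
      exact congrArg g.unop.left.appTop.hom (AdjoinRoot.lift_of (f := F) t.2).symm
    · refine (AdjoinRoot.lift_root (f := F) ((zeroLocus f F).map g t).2).trans ?_
      exact congrArg g.unop.left.appTop.hom (AdjoinRoot.lift_root (f := F) t.2).symm)

theorem isSheaf_zeroLocus {R : Type u} [CommRing R] {X : Scheme.{u}}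
    (f : X ⟶ Spec (CommRingCat.of R)) (F : R[X]) :
    Presheaf.IsSheaf (Scheme.fppfTopology.over X) (zeroLocus f F) := by
  rw [Presheaf.isSheaf_of_iso_iff (zeroLocusIso f F)]
  apply (Over.map f).op_comp_isSheaf_of_isSheaf _ (Scheme.fppfTopology.over _)
  rw [isSheaf_iff_isSheaf_of_type]
  exact GrothendieckTopology.Subcanonical.isSheaf_of_isRepresentable _

/-- The presheaf `U ↦ G_{a,n}(Γ(U, 𝒪_U))`, written additively. -/
noncomputable def kerPresheaf {R : Type u} [CommRing R] [IsDomain R] [IsDiscreteValuationRing R]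
    [CharZero R] {p n : ℕ} [Fact p.Prime] {a : R} (h : Admissible p n a) {X : Scheme.{u}}
    (f : X ⟶ Spec (CommRingCat.of R)) : (Over X)ᵒᵖ ⥤ AddCommGrpCat.{u} where
  obj U := AddCommGrpCat.of (Additive (kerPoints h (structMap f U.unop)))
  map {U V} g := AddCommGrpCat.ofHom
    (kerMap h g.unop.left.appTop.hom (comp_structMap f g.unop)).toAdditive
  map_id U := by
    ext x
    exact Subtype.ext (GPoint.ext (congrArg (fun φ : Γ(U.unop.left, ⊤) ⟶ Γ(U.unop.left, ⊤) =>
      φ.hom (Additive.toMul x).1.val) Scheme.Hom.id_appTop))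
  map_comp {X_1 _ Z_1} g g' := by
    ext x
    exact Subtype.ext (GPoint.ext (congrArg (fun φ : Γ(X_1.unop.left, ⊤) ⟶ Γ(Z_1.unop.left, ⊤) =>
      φ.hom (Additive.toMul x).1.val) (Scheme.Hom.comp_appTop g'.unop.left g.unop.left)))

/-- The functor `G_{a,n}` is represented by `Spec (R[T] / P_{a,n}(T))`, via `zeroLocusIso`. -/
noncomputable def kerPresheafIso {R : Type u} [CommRing R] [IsDomain R] [IsDiscreteValuationRing R]
    [CharZero R] {p n : ℕ} [Fact p.Prime] {a : R} (h : Admissible p n a) {X : Scheme.{u}}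
    (f : X ⟶ Spec (CommRingCat.of R)) :
    kerPresheaf h f ⋙ forget AddCommGrpCat ≅ zeroLocus f (isogenyPoly a (p ^ n)) :=
  NatIso.ofComponents (fun _ => equivEquivIso
    { toFun := fun x => ⟨(Additive.toMul x).1.val, (mem_kerPoints_iff h _ _).1 (Additive.toMul x).2⟩
      invFun := fun t => Additive.ofMul ⟨⟨t.1, isUnit_of_eval₂_eq_zero h _ _ t.2⟩,
        (mem_kerPoints_iff h _ _).2 t.2⟩
      left_inv := fun _ => rfl
      right_inv := fun _ => rfl }) (fun _ => rfl)

/-- The presheaf `U ↦ μ_q(Γ(U, 𝒪_U))`, written additively. -/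
noncomputable def muPresheaf (X : Scheme.{u}) (q : ℕ) : (Over X)ᵒᵖ ⥤ AddCommGrpCat.{u} where
  obj U := AddCommGrpCat.of (Additive (rootsOfUnity q Γ(U.unop.left, ⊤)))
  map {U V} g := AddCommGrpCat.ofHom
    (restrictRootsOfUnity g.unop.left.appTop.hom q).toAdditive
  map_id U := by
    ext x
    exact Subtype.ext (Units.ext (congrArg (fun φ : Γ(U.unop.left, ⊤) ⟶ Γ(U.unop.left, ⊤) =>
      φ.hom (Additive.toMul x).1.val) Scheme.Hom.id_appTop))
  map_comp {X_1 _ Z_1} g g' := by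
    ext x
    exact Subtype.ext (Units.ext (congrArg (fun φ : Γ(X_1.unop.left, ⊤) ⟶ Γ(Z_1.unop.left, ⊤) =>
      φ.hom (Additive.toMul x).1.val) (Scheme.Hom.comp_appTop g'.unop.left g.unop.left)))

/-- The functor `μ_q` is represented by `Spec (R[T] / (T^q - 1))`, via `zeroLocusIso`. -/
noncomputable def muPresheafIso {R : Type u} [CommRing R] {X : Scheme.{u}}
    (f : X ⟶ Spec (CommRingCat.of R)) (q : ℕ) [NeZero q] :
    muPresheaf X q ⋙ forget AddCommGrpCat ≅ zeroLocus f ((Polynomial.X : R[X]) ^ q - 1) :=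
  NatIso.ofComponents (fun U => equivEquivIso
    { toFun := fun x => ⟨((Additive.toMul x).1 : Γ(U.unop.left, ⊤)), by
        have e := (mem_rootsOfUnity' q _).1 (Additive.toMul x).2
        simp [eval₂_sub, eval₂_pow, e]⟩
      invFun := fun t => Additive.ofMul (rootsOfUnity.mkOfPowEq t.1 (by
        have e := t.2
        simpa [eval₂_sub, eval₂_pow, sub_eq_zero] using e))
      left_inv := fun _ => Subtype.ext (Units.ext rfl)
      right_inv := fun _ => rfl }) (fun _ => rfl)

/-- The fppf sheaf `G_{a,n}` on the schemes over `X`. -/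
noncomputable def kerSheaf {R : Type u} [CommRing R] [IsDomain R] [IsDiscreteValuationRing R]
    [CharZero R] {p n : ℕ} [Fact p.Prime] {a : R} (h : Admissible p n a) {X : Scheme.{u}}
    (f : X ⟶ Spec (CommRingCat.of R)) : Sheaf (Scheme.fppfTopology.over X) AddCommGrpCat.{u} :=
  ⟨kerPresheaf h f, by
    apply Presheaf.isSheaf_of_isSheaf_comp _ _ (forget AddCommGrpCat)
    rw [Presheaf.isSheaf_of_iso_iff (kerPresheafIso h f)]
    exact isSheaf_zeroLocus f _⟩

/-- The fppf sheaf `μ_q` on the schemes over `X`. -/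
noncomputable def muSheaf (X : Scheme.{u}) (q : ℕ) [NeZero q] :
    Sheaf (Scheme.fppfTopology.over X) AddCommGrpCat.{u} :=
  ⟨muPresheaf X q, by
    apply Presheaf.isSheaf_of_isSheaf_comp _ _ (forget AddCommGrpCat)
    rw [Presheaf.isSheaf_of_iso_iff (muPresheafIso
      (R := ULift.{u} ℤ) (specULiftZIsTerminal.from X) q)]
    exact isSheaf_zeroLocus _ _⟩

/-- The morphism `α^{a,n} : G_{a,n} → μ_{p^n}`, `t ↦ 1 + a t`. -/
noncomputable def alphaHom {R : Type u} [CommRing R] [IsDomain R] [IsDiscreteValuationRing R]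
    [CharZero R] {p n : ℕ} [Fact p.Prime] {a : R} (h : Admissible p n a) {X : Scheme.{u}}
    (f : X ⟶ Spec (CommRingCat.of R)) : kerSheaf h f ⟶ muSheaf X (p ^ n) :=
  ⟨{ app := fun U => AddCommGrpCat.ofHom (kerAlpha h (structMap f U.unop)).toAdditive
     naturality := fun U V g => by
       ext x
       refine Subtype.ext (Units.ext ?_)
       change 1 + structMap f V.unop a * g.unop.left.appTop.hom (Additive.toMul x).1.val =
         g.unop.left.appTop.hom (1 + structMap f U.unop a * (Additive.toMul x).1.val)
       rw [← comp_structMap f g.unop, map_add, map_one, map_mul]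
       rfl }⟩

/-- The morphism `G_{a,n} → G_{b,n}`, `t ↦ (a / b) t`, where `a = c b`. -/
noncomputable def scaleHom {R : Type u} [CommRing R] [IsDomain R] [IsDiscreteValuationRing R]
    [CharZero R] {p n : ℕ} [Fact p.Prime] {a b c : R} (ha : Admissible p n a)
    (hb : Admissible p n b) (hc : a = c * b) {X : Scheme.{u}}
    (f : X ⟶ Spec (CommRingCat.of R)) : kerSheaf ha f ⟶ kerSheaf hb f :=
  ⟨{ app := fun U => AddCommGrpCat.ofHom (kerScale ha hb hc (structMap f U.unop)).toAdditive
     naturality := fun U V g => by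
       ext x
       refine Subtype.ext (GPoint.ext ?_)
       change structMap f V.unop c * g.unop.left.appTop.hom (Additive.toMul x).1.val =
         g.unop.left.appTop.hom (structMap f U.unop c * (Additive.toMul x).1.val)
       rw [← comp_structMap f g.unop, map_mul]
       rfl }⟩

instance (X : Scheme.{u}) :
    IsGrothendieckAbelian.{u + 1} (Sheaf (Scheme.fppfTopology.over X) AddCommGrpCat.{u + 1}) := by
  have : EssentiallySmall.{u + 1} (Over X) := inferInstance
  exact Sheaf.isGrothendieckAbelian_of_essentiallySmall _ AddCommGrpCat.{u + 1}

/-- The fppf cohomology functor `F ↦ H^i(X, F)` on the big fppf site of `X`, that is,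
`Ext^i(ℤ, F)`. As this site is large, the values of `F` are first lifted to the next universe. -/
noncomputable def fppfH (X : Scheme.{u}) (i : ℕ) :
    Sheaf (Scheme.fppfTopology.over X) AddCommGrpCat.{u} ⥤ AddCommGrpCat.{u + 1} :=
  sheafCompose _ AddCommGrpCat.uliftFunctor.{u + 1, u} ⋙ Sheaf.functorH _ i

/-- A scheme is normal if its local rings are integrally closed domains. -/
class IsNormalScheme (X : Scheme.{u}) : Prop where
  isDomain_stalk : ∀ x : X, IsDomain (X.presheaf.stalk x)
  isIntegrallyClosed_stalk : ∀ x : X, IsIntegrallyClosed (X.presheaf.stalk x)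

end Sheaves

end FppfFiltration

open FppfFiltration

/-! Part 2 follows formally from part 1: the maps `α` are compatible with scaling, and the first
factor of an injective composite is injective.

For part 1, put `q = p ^ n`. A class of `H¹(X, G)` that dies in `H¹(X, μ_q)` gives a `G`-torsor with
an equivariant map to `μ_q` (`ext_eq_zero_of_comp_mk₀_eq_zero`, `TrivializedTorsor.ofExtension`),
and it suffices to find a global point of it. Near a given point of `X`, take a point of the torsor
over a flat `U`, with image `m` in `μ_q(U)`. Where `a = 0`, the map `t ↦ 1 + a t` is trivial, so all
points of the torsor have the same image there, and `m` modulo `a` descends to a function `y` modulo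
`a` on an affine open of `X` (`exists_image`, `exists_vanishing_scheme`). Admissibility gives `a ^
(q - k) ∣ q.choose k`. Hence `m ^ q = 1` yields, by faithfully flat descent of an ideal membership,
an integral equation for `(y - 1) / a` over a normal local ring. So `a` divides `y - 1`, and
therefore `m - 1` (`dvd_of_one_add_pow_eq_one`).

Thus locally `m = 1 + a t`. As `a` is regular on flat schemes, `t` is a point of `G`, and
translation by `t` produces a point of the torsor with image `1`. On flat `X`-schemes `α` is
injective, so such points are unique and glue (`exists_glue`). -/

namespace FppfFiltration

/-! ### Divisibility in normal domains and faithfully flat descent. -/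

/-- If `y` satisfies an equation `y ^ q = ∑ c k * (l ^ (q - k) * y ^ k)`, then `y / l` is integral. -/
theorem dvd_of_pow_mem_span {A : Type*} [CommRing A] [IsDomain A] [IsIntegrallyClosed A] {q : ℕ}
    {l y : A} (hl : l ≠ 0)
    (h : y ^ q ∈ Ideal.span (Set.range fun k : Fin q => l ^ (q - k) * y ^ (k : ℕ))) : l ∣ y := by
  obtain ⟨c, hc⟩ := Ideal.mem_span_range_iff_exists_fun.1 h
  have hl' : algebraMap A (FractionRing A) l ≠ 0 := by simpa using hl
  have hint : IsIntegral A (algebraMap A (FractionRing A) y / algebraMap A (FractionRing A) l) := by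
    -- Dividing the relation `y ^ q = ∑ c k * (l ^ (q - k) * y ^ k)` by `l ^ q` gives this monic
    -- equation for `y / l`.
    refine ⟨X ^ q - ∑ k : Fin q, C (c k) * X ^ (k : ℕ), monic_X_pow_sub ?_, ?_⟩
    · exact degree_sum_fin_lt c
    · rw [eval₂_sub, eval₂_finsetSum, eval₂_X_pow, sub_eq_zero]
      simp only [eval₂_mul, eval₂_C, eval₂_X_pow]
      have := congrArg (algebraMap A (FractionRing A)) hc
      simp only [map_sum, map_mul, map_pow] at this
      rw [div_pow, ← this, Finset.sum_div]
      refine Finset.sum_congr rfl fun k _ => ?_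
      have e : algebraMap A (FractionRing A) l ^ q = algebraMap A (FractionRing A) l ^ (q - k) * algebraMap A (FractionRing A) l ^ (k : ℕ) := by
        rw [← pow_add]; congr 1; omega
      rw [e, div_pow]
      field_simp
  obtain ⟨a, ha⟩ := IsIntegrallyClosed.isIntegral_iff.1 hint
  refine ⟨a, IsFractionRing.injective A (FractionRing A) ?_⟩
  rw [map_mul, ha, mul_div_cancel₀ _ hl']

/-- If the `q`-th root of unity `1 + z` is congruent modulo `l`, over a faithfully flat extension, to
an element `1 + y` of a normal domain, then `l` divides `y`. -/
theorem dvd_of_one_add_pow_eq_one {A B : Type*} [CommRing A] [IsDomain A] [IsIntegrallyClosed A]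
    [CommRing B] [Algebra A B] [Module.FaithfullyFlat A B] {q : ℕ} {l : A} (hl : l ≠ 0)
    (hq : ∀ k, 0 < k → k < q → l ^ (q - k) ∣ (q.choose k : A)) (y : A) (z b : B)
    (hz : z = algebraMap A B y + algebraMap A B l * b) (hzq : (1 + z) ^ q = 1) (hq0 : 0 < q) :
    l ∣ y := by
  apply dvd_of_pow_mem_span (q := q) hl
  set J := Ideal.span (Set.range fun k : Fin q => l ^ (q - k) * y ^ (k : ℕ)) with hJ
  -- The ideal is contracted from `B`, so the membership may be proved there, where `z` is
  -- available.
  rw [← Ideal.comap_map_eq_self_of_faithfullyFlat (B := B) J, Ideal.mem_comap]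
  set L := algebraMap A B l
  set Y := algebraMap A B y
  have mem : ∀ k j, k + j = q → 0 < j → ∀ c, c * (L ^ j * Y ^ k) ∈ J.map (algebraMap A B) := by
    intro k j hkj hj c
    refine Ideal.mul_mem_left _ _ ?_
    have := Ideal.mem_map_of_mem (algebraMap A B)
      (Ideal.subset_span ⟨(⟨k, by omega⟩ : Fin q), rfl⟩ : l ^ (q - k) * y ^ k ∈ J)
    rw [map_mul, map_pow, map_pow] at this
    rwa [← Nat.eq_sub_of_add_eq' hkj] at this
  -- Replacing `Y` by `z = Y + L b` keeps the total degree `q` in `(L, Y)` and at least one factor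
  -- `L`.
  have memz : ∀ k j, k + j = q → 0 < j → ∀ c, c * (L ^ j * z ^ k) ∈ J.map (algebraMap A B) := by
    intro k j hkj hj c
    rw [hz, add_pow, Finset.mul_sum, Finset.mul_sum]
    refine Ideal.sum_mem _ fun i hi => ?_
    rw [Finset.mem_range] at hi
    have := mem i (j + (k - i)) (by omega) (by omega) (c * b ^ (k - i) * k.choose i)
    convert this using 1
    ring
  have h1 : z ^ q ∈ J.map (algebraMap A B) := by
    obtain ⟨s, rfl⟩ : ∃ s, q = s + 1 := ⟨q - 1, by omega⟩
    rw [add_comm, add_pow, Finset.sum_range_succ, Finset.sum_range_succ'] at hzq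
    have e : z ^ (s + 1) = -∑ i ∈ Finset.range s, z ^ (i + 1) * ((s + 1).choose (i + 1) : B) := by
      simp only [one_pow, mul_one, pow_zero, Nat.choose_zero_right, Nat.cast_one,
        Nat.choose_self] at hzq
      linear_combination hzq
    rw [e]
    refine neg_mem (Ideal.sum_mem _ fun i hi => ?_)
    rw [Finset.mem_range] at hi
    obtain ⟨d, hd⟩ := hq (i + 1) (by omega) (by omega)
    have := memz (i + 1) (s + 1 - (i + 1)) (by omega) (by omega) (algebraMap A B d)
    convert this using 1
    rw [← map_natCast (algebraMap A B), hd, map_mul, map_pow]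
    ring
  have hY : Y = z + L * -b := by rw [hz]; ring
  rw [map_pow]
  change Y ^ q ∈ _
  rw [hY, add_pow]
  refine Ideal.sum_mem _ fun i hi => ?_
  rw [Finset.mem_range] at hi
  -- Only the top term `z ^ q` lacks a factor `L`; it is covered by `h1`.
  rcases (Nat.lt_succ_iff.1 hi).eq_or_lt with rfl | hlt
  · exact Ideal.mul_mem_right _ _ (Ideal.mul_mem_right _ _ h1)
  · have := memz i (q - i) (by omega) (by omega) ((-b) ^ (q - i) * q.choose i)
    convert this using 1
    ring

/-- Comparing coefficients of `T ^ k` in `a ^ q * P = (1 + a T) ^ q - 1` and cancelling `a ^ k`: the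
integrality of the isogeny polynomial is exactly the divisibility that the normality argument needs.
-/
theorem pow_sub_dvd_choose {R : Type*} [CommRing R] [IsDomain R] [IsDiscreteValuationRing R]
    [CharZero R] {p n : ℕ} [Fact p.Prime] {a : R} (h : Admissible p n a) {k : ℕ} (hk : k ≤ p ^ n)
    (hk0 : 0 < k) : a ^ (p ^ n - k) ∣ ((p ^ n).choose k : R) := by
  have e := congrArg (fun Q : R[X] => Q.coeff k) (isogenyPoly_spec h)
  have e1 : ((1 + C a * X : R[X]) ^ p ^ n).coeff k = a ^ k * (p ^ n).choose k := by
    have : (1 + C a * X : R[X]) ^ p ^ n = ((1 + X) ^ p ^ n).comp (C a * X) := by simp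
    rw [this, comp_C_mul_X_coeff, coeff_one_add_X_pow, mul_comm]
  simp only [coeff_C_mul, coeff_sub, e1, coeff_one, if_neg hk0.ne', sub_zero] at e
  refine ⟨(isogenyPoly a (p ^ n)).coeff k, mul_left_cancel₀ (pow_ne_zero k h.ne_zero) ?_⟩
  rw [← e, ← mul_assoc, ← pow_add, Nat.add_sub_cancel' hk]

/-! ### Classes in `Ext¹` killed by a morphism. -/

open Limits Abelian

/-- A class in `Ext¹(Z, G)` killed by `α : G ⟶ M` comes from an extension on which `α` becomes the
restriction of a homomorphism. If all such extensions split over `Z`, then `α` is injective on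
`Ext¹(Z, -)`. -/
theorem ext_eq_zero_of_comp_mk₀_eq_zero {C : Type*} [Category* C] [Abelian C] [EnoughInjectives C]
    [HasExt C] {G M Z : C} (α : G ⟶ M)
    (H : ∀ {I Q J P : C} (ι : G ⟶ I) (π : I ⟶ Q) (κ : M ⟶ J) (ρ : J ⟶ P) (φ : I ⟶ J) (ψ : Q ⟶ P)
      (hS : ι ≫ π = 0) (hT : κ ≫ ρ = 0), (ShortComplex.mk ι π hS).ShortExact →
      (ShortComplex.mk κ ρ hT).ShortExact → ι ≫ φ = α ≫ κ → φ ≫ ρ = π ≫ ψ →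
      ∀ (q : Z ⟶ Q) (w : Z ⟶ J), w ≫ ρ = q ≫ ψ → ∃ e : Z ⟶ I, e ≫ π = q)
    (x : Ext Z G 1) (hx : x.comp (Ext.mk₀ α) (add_zero 1) = 0) : x = 0 := by
  let S : ShortComplex C := ⟨Injective.ι G, cokernel.π (Injective.ι G), cokernel.condition _⟩
  let T : ShortComplex C := ⟨Injective.ι M, cokernel.π (Injective.ι M), cokernel.condition _⟩
  have hS : S.ShortExact :=
    { exact := ShortComplex.exact_of_g_is_cokernel _ (cokernelIsCokernel _) }
  have hT : T.ShortExact :=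
    { exact := ShortComplex.exact_of_g_is_cokernel _ (cokernelIsCokernel _) }
  let ψ : Injective.under G ⟶ Injective.under M :=
    Injective.factorThru (α ≫ Injective.ι M) (Injective.ι G)
  have hψ : Injective.ι G ≫ ψ = α ≫ Injective.ι M := Injective.comp_factorThru _ _
  let φ : S ⟶ T :=
    { τ₁ := α
      τ₂ := ψ
      τ₃ := cokernel.map _ _ α ψ hψ
      comm₁₂ := hψ.symm
      comm₂₃ := by simp [S, T] }
  have : Injective S.X₂ := inferInstanceAs (Injective (Injective.under G))
  -- `x` dies in `Ext¹` of the injective object, so it is the connecting image of some `q`.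
  obtain ⟨q, hq⟩ := Ext.covariant_sequence_exact₁ Z hS x (Ext.eq_zero_of_injective _) (zero_add 1)
  obtain ⟨q, rfl⟩ := (Ext.mk₀_bijective _ _).2 q
  -- By naturality of the connecting class, the image of `x` under `α` is the obstruction to lifting
  -- `q ≫ φ.τ₃` to `T.X₂`.
  have h0 : (Ext.mk₀ (q ≫ φ.τ₃)).comp hT.extClass (zero_add 1) = 0 := by
    rw [← Ext.mk₀_comp_mk₀, Ext.comp_assoc_of_second_deg_zero,
      ← ShortComplex.ShortExact.extClass_naturality hS hT φ,
      ← Ext.comp_assoc_of_third_deg_zero, hq]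
    exact hx
  obtain ⟨w, hw⟩ := Ext.covariant_sequence_exact₃ Z hT _ (zero_add 1) h0
  obtain ⟨w, rfl⟩ := (Ext.mk₀_bijective _ _).2 w
  rw [Ext.mk₀_comp_mk₀] at hw
  obtain ⟨e, he⟩ := H S.f S.g T.f T.g φ.τ₂ φ.τ₃ S.zero T.zero hS hT φ.comm₁₂.symm φ.comm₂₃ q w
    ((Ext.mk₀_bijective _ _).1 hw)
  rw [← hq, ← he, ← Ext.mk₀_comp_mk₀, Ext.comp_assoc_of_second_deg_zero, hS.comp_extClass,
    Ext.comp_zero]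

/-! ### Sections of exact sequences of fppf sheaves. -/

section Sites

variable {X : Scheme.{u}}

/-- The topology of the big fppf site of `X`. -/
abbrev J (X : Scheme.{u}) := Scheme.fppfTopology.over X

theorem imageSieve_mem_of_epi {F G : Sheaf (J X) AddCommGrpCat.{u + 1}} (g : F ⟶ G) [Epi g]
    {U : Over X} (s : G.obj.obj (op U)) : Presheaf.imageSieve g.hom s ∈ J X U := by
  have : Sheaf.IsLocallySurjective g := (Sheaf.isLocallySurjective_iff_epi' _ g).2 inferInstance
  exact Presheaf.imageSieve_mem _ _ _

/-- Taking sections over `U` is left exact. Surjectivity of `S.g` survives only locally, as in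
`imageSieve_mem_of_epi`. -/
theorem exists_section_of_exact {S : ShortComplex (Sheaf (J X) AddCommGrpCat.{u + 1})}
    (hS : S.ShortExact) (U : Over X) (s : S.X₂.obj.obj (op U)) (hs : S.g.hom.app (op U) s = 0) :
    ∃ t : S.X₁.obj.obj (op U), S.f.hom.app (op U) t = s := by
  let F := sheafToPresheaf (J X) AddCommGrpCat.{u + 1} ⋙ (evaluation _ _).obj (op U)
  have := hS.mono_f
  have h := hS.exact.map_of_mono_of_preservesKernel F inferInstance inferInstance
  exact (ShortComplex.ab_exact_iff _).1 h s hs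

theorem injective_app_of_mono {F G : Sheaf (J X) AddCommGrpCat.{u + 1}} (g : F ⟶ G) [Mono g]
    (U : Over X) : Function.Injective (g.hom.app (op U)) := by
  let E := sheafToPresheaf (J X) AddCommGrpCat.{u + 1} ⋙ (evaluation _ _).obj (op U)
  have : Mono (E.map g) := inferInstance
  exact (AddCommGrpCat.mono_iff_injective _).1 this

end Sites

/-! ### Flatness: regularity of `a` and congruences modulo `a`, on stalks and on open sets. -/

theorem isLeftRegular_map_of_flat {A B : Type*} [CommRing A] [CommRing B] (g : A →+* B)
    (hg : g.Flat) {a : A} (ha : IsLeftRegular a) : IsLeftRegular (g a) := by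
  algebraize [g]
  exact IsSMulRegular.of_flat (S := B) (show IsSMulRegular A a from ha)

/-- A flat local homomorphism is faithfully flat, so `dvd_of_one_add_pow_eq_one` applies to `y - 1`
and `m - 1`; the divisibility passes from `y - 1` to `m - 1` because `m - g y` is a multiple of `g
l`. -/
theorem dvd_sub_one_of_flat {A B : Type*} [CommRing A] [IsDomain A] [IsIntegrallyClosed A]
    [IsLocalRing A] [CommRing B] [IsLocalRing B] (g : A →+* B) [IsLocalHom g] (hg : g.Flat) {q : ℕ}
    (hq0 : 0 < q) {l : A} (hl : l ≠ 0) (hq : ∀ k, 0 < k → k < q → l ^ (q - k) ∣ (q.choose k : A))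
    {y : A} {m b : B} (hm : m = g y + g l * b) (hmq : m ^ q = 1) : g l ∣ m - 1 := by
  algebraize [g]
  have : IsLocalHom (algebraMap A B) := ‹IsLocalHom g›
  have : Module.FaithfullyFlat A B := Module.FaithfullyFlat.of_flat_of_isLocalHom
  obtain ⟨c, hc⟩ := dvd_of_one_add_pow_eq_one (B := B) hl hq (y - 1) (m - 1) b
    (by
      rw [map_sub, map_one, hm]
      change _ = g y - 1 + g l * b
      ring) (by rw [add_sub_cancel, hmq]) hq0
  refine ⟨g c + b, ?_⟩
  have e := congrArg g hc
  rw [map_sub, map_one, map_mul] at e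
  rw [hm]
  linear_combination e

section Flatness

variable {R : Type u} [CommRing R] [IsDomain R]

theorem isLeftRegular_germ_of_flat {V : Scheme.{u}} (h : V ⟶ Spec (CommRingCat.of R)) [Flat h] (v : V)
    {a : R} (ha : a ≠ 0) :
    IsLeftRegular (V.presheaf.germ ⊤ v trivial
      (((Scheme.ΓSpecIso (CommRingCat.of R)).inv ≫ h.appTop).hom a)) := by
  have hflat := Flat.stalkMap h v
  set b := (Spec (CommRingCat.of R)).presheaf.germ ⊤ (h v) trivial
    ((Scheme.ΓSpecIso (CommRingCat.of R)).inv.hom a) with hb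
  have hb0 : b ≠ 0 := by
    intro h0
    have inj : Function.Injective ((Spec (CommRingCat.of R)).presheaf.germ ⊤ (h v) trivial).hom :=
      germ_injective_of_isIntegral _ _ _
    have h1 := inj (h0.trans (map_zero _).symm)
    have inj2 : Function.Injective (Scheme.ΓSpecIso (CommRingCat.of R)).inv.hom :=
      (Scheme.ΓSpecIso (CommRingCat.of R)).symm.commRingCatIsoToRingEquiv.injective
    exact ha (inj2 (h1.trans (map_zero _).symm))
  have e : (h.stalkMap v).hom b = V.presheaf.germ ⊤ v trivial
      (((Scheme.ΓSpecIso (CommRingCat.of R)).inv ≫ h.appTop).hom a) :=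
    Scheme.Hom.germ_stalkMap_apply h ⊤ v trivial _
  rw [← e]
  exact isLeftRegular_map_of_flat _ hflat (IsRegular.of_ne_zero hb0).left

/-- Checked on germs. This makes `α` injective over flat schemes and allows powers of `a` to be
cancelled in the equation of `G`. -/
theorem isLeftRegular_structMap {X : Scheme.{u}} (f : X ⟶ Spec (CommRingCat.of R)) (V : Over X)
    [Flat (V.hom ≫ f)] {a : R} (ha : a ≠ 0) : IsLeftRegular (structMap f V a) := by
  rw [isLeftRegular_iff_right_eq_zero_of_mul]
  intro s hs
  refine TopCat.Presheaf.section_ext V.left.sheaf ⊤ s 0 fun v _ => ?_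
  have h1 := congrArg (V.left.presheaf.germ ⊤ v trivial).hom hs
  rw [map_mul, map_zero] at h1
  have := (isLeftRegular_iff_right_eq_zero_of_mul.1
    (isLeftRegular_germ_of_flat (V.hom ≫ f) v ha)) _ h1
  exact this.trans (map_zero _).symm

end Flatness

/-- A root of unity on `V`, flat over `W` normal at the image of `v`, that is congruent modulo `l`
to a function on `W` is congruent to `1` modulo `l` near `v`. -/
theorem exists_opens_dvd_sub_one {V W : Scheme.{u}} (h : V ⟶ W) [Flat h] (v : V)
    [IsDomain (W.presheaf.stalk (h v))] [IsIntegrallyClosed (W.presheaf.stalk (h v))]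
    (l y : Γ(W, ⊤)) (hl : W.presheaf.germ ⊤ (h v) trivial l ≠ 0) {q : ℕ} (hq0 : 0 < q)
    (hq : ∀ k, 0 < k → k < q → l ^ (q - k) ∣ (q.choose k : Γ(W, ⊤))) (m b : Γ(V, ⊤))
    (hm : m = h.appTop.hom y + h.appTop.hom l * b) (hmq : m ^ q = 1) :
    ∃ (V' : V.Opens) (_ : v ∈ V') (t : Γ(V', ⊤)),
      V'.ι.appTop.hom m = 1 + V'.ι.appTop.hom (h.appTop.hom l) * t := by
  let gW := (W.presheaf.germ ⊤ (h v) trivial).hom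
  let gV := (V.presheaf.germ ⊤ v trivial).hom
  have comm : ∀ s, (h.stalkMap v).hom (gW s) = gV (h.appTop.hom s) :=
    fun s => Scheme.Hom.germ_stalkMap_apply h ⊤ v trivial _
  obtain ⟨c, hc⟩ := dvd_sub_one_of_flat (h.stalkMap v).hom (Flat.stalkMap h v) hq0 hl
    (fun k h1 h2 => by simpa using map_dvd gW (hq k h1 h2)) (y := gW y) (m := gV m) (b := gV b)
    (by
      change _ = _ + (h.stalkMap v).hom (gW l) * _
      rw [comm, comm, hm, map_add, map_mul])
    (by rw [← map_pow, hmq, map_one])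
  have key : gV (m - 1) = gV (h.appTop.hom l) * c := by
    rw [map_sub, map_one, hc]
    exact congrArg (· * c) (comm l)
  -- The quotient `c` extends to a neighbourhood `V₁`, and the identity of germs then holds on a
  -- smaller `V₂`.
  obtain ⟨V₁, hv₁, t, rfl⟩ := V.presheaf.exists_germ_eq c
  have key2 : V.presheaf.germ V₁ v hv₁ (V.presheaf.map (homOfLE le_top).op (m - 1)) =
      V.presheaf.germ V₁ v hv₁ (V.presheaf.map (homOfLE le_top).op (h.appTop.hom l) * t) := by
    rw [map_mul, TopCat.Presheaf.germ_res_apply, TopCat.Presheaf.germ_res_apply]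
    exact key
  obtain ⟨(V₂ : V.Opens), hv₂, i, j, hij⟩ := V.presheaf.germ_eq v hv₁ hv₁ _ _ key2
  -- Global sections of the scheme `V₂` are sections of `V` over the image of `⊤`, so one more
  -- restriction is needed.
  have hle : V₂.ι ''ᵁ ⊤ ≤ V₂ := by simp
  refine ⟨V₂, hv₂, V.presheaf.map (homOfLE (hle.trans i.le)).op t, ?_⟩
  have hij2 := congrArg (V.presheaf.map (homOfLE hle).op).hom hij
  have e : ∀ s : Γ(V, ⊤), (V.presheaf.map (homOfLE hle).op).hom ((V.presheaf.map i.op).hom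
      ((V.presheaf.map (homOfLE le_top).op).hom s)) = V₂.ι.appTop.hom s := fun s => by
    rw [← RingHom.comp_apply, ← RingHom.comp_apply, ← CommRingCat.hom_comp, ← CommRingCat.hom_comp,
      ← V.presheaf.map_comp, ← V.presheaf.map_comp]
    rfl
  have e' : (V.presheaf.map (homOfLE hle).op).hom ((V.presheaf.map j.op).hom t) =
      V.presheaf.map (homOfLE (hle.trans i.le)).op t := by
    rw [← RingHom.comp_apply, ← CommRingCat.hom_comp, ← V.presheaf.map_comp]
    rfl
  obtain rfl : i = j := Subsingleton.elim _ _
  change (V.presheaf.map (homOfLE hle).op).hom ((V.presheaf.map i.op).hom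
      ((V.presheaf.map (homOfLE le_top).op).hom (m - 1))) = (V.presheaf.map (homOfLE hle).op).hom
      ((V.presheaf.map i.op).hom ((V.presheaf.map (homOfLE le_top).op).hom (h.appTop.hom l) * t))
    at hij2
  rw [map_mul, map_mul, e, e, e', map_sub, map_one] at hij2
  exact sub_eq_iff_eq_add'.1 hij2

/-- The closed subscheme `l = 0` of an affine scheme `Spec A`, and its use to compare functions
modulo `l`. -/
theorem exists_vanishing_scheme {A B : CommRingCat.{u}} (h : Spec B ⟶ Spec A) (l : Γ(Spec A, ⊤))
    (m : Γ(Spec B, ⊤)) :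
    ∃ (Y : Scheme.{u}) (i : Y ⟶ Spec A), i.appTop.hom l = 0 ∧ ∀ s : Γ(Y, ⊤),
      (∀ (Z : Scheme.{u}) (a : Z ⟶ Spec B) (b : Z ⟶ Y), a ≫ h = b ≫ i →
        a.appTop.hom m = b.appTop.hom s) →
      ∃ (y : Γ(Spec A, ⊤)) (c : Γ(Spec B, ⊤)), m = h.appTop.hom y + h.appTop.hom l * c := by
  obtain ⟨ψ, rfl⟩ : ∃ ψ, Spec.map ψ = h := ⟨_, Spec.map_preimage h⟩
  have nat : ∀ {R S : CommRingCat.{u}} (g : R ⟶ S) (r : R), (Spec.map g).appTop.hom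
      ((Scheme.ΓSpecIso R).inv.hom r) = (Scheme.ΓSpecIso S).inv.hom (g.hom r) := fun g r =>
    (congrArg (fun χ => χ.hom r) (Scheme.ΓSpecIso_inv_naturality g)).symm
  have surj : ∀ {R : CommRingCat.{u}} (s : Γ(Spec R, ⊤)), ∃ r, (Scheme.ΓSpecIso R).inv.hom r = s :=
    fun {R} => (Scheme.ΓSpecIso R).symm.commRingCatIsoToRingEquiv.surjective
  have inj : ∀ {R : CommRingCat.{u}}, Function.Injective (Scheme.ΓSpecIso R).inv.hom :=
    fun {R} => (Scheme.ΓSpecIso R).symm.commRingCatIsoToRingEquiv.injective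
  obtain ⟨l, rfl⟩ := surj l
  obtain ⟨m, rfl⟩ := surj m
  let I : Ideal A := Ideal.span {l}
  let IB : Ideal B := Ideal.span {ψ.hom l}
  let mkA : A ⟶ CommRingCat.of (A ⧸ I) := CommRingCat.ofHom (Ideal.Quotient.mk I)
  let mkB : B ⟶ CommRingCat.of (B ⧸ IB) := CommRingCat.ofHom (Ideal.Quotient.mk IB)
  let g : CommRingCat.of (A ⧸ I) ⟶ CommRingCat.of (B ⧸ IB) :=
    CommRingCat.ofHom (Ideal.quotientMap IB ψ.hom (by
      rw [Ideal.span_singleton_le_iff_mem]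
      exact Ideal.mem_span_singleton_self _))
  have hg : mkA ≫ g = ψ ≫ mkB := by
    ext a
    rfl
  refine ⟨_, Spec.map mkA, ?_, fun s hs => ?_⟩
  · rw [nat]
    have : mkA.hom l = 0 := Ideal.Quotient.eq_zero_iff_mem.2 (Ideal.mem_span_singleton_self _)
    rw [this, map_zero]
  · obtain ⟨s, rfl⟩ := surj s
    obtain ⟨y, rfl⟩ := Ideal.Quotient.mk_surjective s
    -- The single test scheme `Spec (B / l)` suffices: a lift `y` of `s` to `A` agrees with `m`
    -- modulo `l`.
    have h1 := hs _ (Spec.map mkB) (Spec.map g) (by rw [← Spec.map_comp, ← Spec.map_comp, hg])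
    rw [nat, nat] at h1
    have h2 : mkB.hom m = mkB.hom (ψ.hom y) :=
      (inj h1).trans (congrArg (fun χ => χ.hom y) hg)
    obtain ⟨c, hc⟩ := Ideal.mem_span_singleton'.1 (Ideal.Quotient.eq.1 h2)
    refine ⟨(Scheme.ΓSpecIso A).inv.hom y, (Scheme.ΓSpecIso B).inv.hom c, ?_⟩
    rw [nat, nat, ← map_mul, ← map_add]
    congr 1
    linear_combination -hc

/-- Since `j` is a monomorphism, the first projection of the pullback of `h ≫ j` along `j` is a
monomorphism with section `s`, hence an isomorphism. So `h` is an isomorphism followed by a base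
change of `h ≫ j`. -/
theorem flat_of_flat_comp_isOpenImmersion {V W X : Scheme.{u}} (h : V ⟶ W) (j : W ⟶ X)
    [IsOpenImmersion j] [Flat (h ≫ j)] : Flat h := by
  let s := Limits.pullback.lift (f := h ≫ j) (g := j) (𝟙 V) h (Category.id_comp _)
  have hs : s ≫ Limits.pullback.fst (h ≫ j) j = 𝟙 V := Limits.pullback.lift_fst _ _ _
  have h2 : s ≫ Limits.pullback.snd (h ≫ j) j = h := Limits.pullback.lift_snd _ _ _
  have : IsIso (Limits.pullback.fst (h ≫ j) j) :=
    have : Mono (Limits.pullback.fst (h ≫ j) j) := inferInstance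
    have : IsSplitEpi (Limits.pullback.fst (h ≫ j) j) := ⟨⟨⟨s, hs⟩⟩⟩
    isIso_of_mono_of_isSplitEpi _
  have : IsIso s := IsIso.of_isIso_fac_right hs
  rw [← h2]
  infer_instance

section

variable {R : Type u} [CommRing R] [IsDomain R]

/-- Let `m` be a root of unity on a flat `X`-scheme `U` such that `m` descends to each `X`-scheme
on which `a` vanishes. If `X` is normal, then `m` is congruent to `1` modulo `a`, locally on `U`. -/
theorem exists_open_congr_one {X : Scheme.{u}} [IsNormalScheme X]
    (f : X ⟶ Spec (CommRingCat.of R)) [Flat f] {a : R} (ha : a ≠ 0) {q : ℕ} (hq0 : 0 < q)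
    (hq : ∀ k, 0 < k → k < q → a ^ (q - k) ∣ (q.choose k : R)) (U : Over X) [Flat U.hom]
    (u : U.left) (m : Γ(U.left, ⊤)) (hm : m ^ q = 1)
    (H : ∀ Y : Over X, structMap f Y a = 0 → ∃ s : Γ(Y.left, ⊤), ∀ (Z : Over X) (i : Z ⟶ U)
      (j : Z ⟶ Y), i.left.appTop.hom m = j.left.appTop.hom s) :
    ∃ (V : Over X) (k : V ⟶ U) (_ : IsOpenImmersion k.left) (_ : u ∈ Set.range k.left)
      (t : Γ(V.left, ⊤)), k.left.appTop.hom m = 1 + structMap f V a * t := by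
  -- Reduction to affine opens: `Spec A` around the image of `u`, and `Spec B` around `u` mapping
  -- into it.
  obtain ⟨A, j, hj, hxj, -⟩ := Scheme.exists_affine_mem_range_and_range_subset
    (show U.hom u ∈ (⊤ : X.Opens) from trivial)
  obtain ⟨B, k, hk, ⟨v, hv⟩, hkr⟩ := Scheme.exists_affine_mem_range_and_range_subset
    (show u ∈ U.hom ⁻¹ᵁ j.opensRange from hxj)
  have hr : Set.range (k ≫ U.hom) ⊆ Set.range j := by
    rintro _ ⟨b, rfl⟩
    have := hkr ⟨b, rfl⟩
    simpa using this
  let h : Spec B ⟶ Spec A := IsOpenImmersion.lift j (k ≫ U.hom) hr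
  have hh : h ≫ j = k ≫ U.hom := IsOpenImmersion.lift_fac _ _ _
  have hflat : Flat h := by
    have : Flat (h ≫ j) := by rw [hh]; infer_instance
    exact flat_of_flat_comp_isOpenImmersion h j
  let W : Over X := Over.mk j
  have : IsDomain (X.presheaf.stalk (j (h v))) := IsNormalScheme.isDomain_stalk _
  have : IsIntegrallyClosed (X.presheaf.stalk (j (h v))) :=
    IsNormalScheme.isIntegrallyClosed_stalk _
  let e : X.presheaf.stalk (j (h v)) ≃+* (Spec A).presheaf.stalk (h v) :=
    (asIso (j.stalkMap (h v))).commRingCatIsoToRingEquiv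
  have : IsDomain ((Spec A).presheaf.stalk (h v)) := e.symm.toMulEquiv.isDomain _
  have : IsIntegrallyClosed ((Spec A).presheaf.stalk (h v)) := IsIntegrallyClosed.of_equiv e
  obtain ⟨Y, i, hi, HY⟩ := exists_vanishing_scheme h (structMap f W a) (k.appTop.hom m)
  -- The hypothesis is used only for the closed subscheme `a = 0` of `Spec A`.
  obtain ⟨s, hs⟩ := H (Over.mk (i ≫ j)) (by
    rw [← comp_structMap f (Over.homMk i : Over.mk (i ≫ j) ⟶ W)]
    exact hi)
  obtain ⟨y, c, hyc⟩ := HY s (fun Z α β hαβ => by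
    have := hs (Over.mk (α ≫ k ≫ U.hom)) (Over.homMk (α ≫ k))
      (Over.homMk β (by simp [← hh, reassoc_of% hαβ]))
    change (α ≫ k).appTop.hom m = β.appTop.hom s at this
    rwa [Scheme.Hom.comp_appTop] at this)
  have hWflat : Flat (W.hom ≫ f) := inferInstanceAs (Flat (j ≫ f))
  have hl := (isLeftRegular_germ_of_flat (W.hom ≫ f) (h v) ha).ne_zero
  obtain ⟨V', hv', t, ht⟩ := exists_opens_dvd_sub_one h v (structMap f W a) y hl hq0
    (fun k h1 h2 => by simpa using map_dvd (structMap f W) (hq k h1 h2)) (k.appTop.hom m) c hyc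
    (by rw [← map_pow, hm, map_one])
  refine ⟨Over.mk (V'.ι ≫ k ≫ U.hom), Over.homMk (V'.ι ≫ k),
    (inferInstance : IsOpenImmersion (V'.ι ≫ k)), ⟨⟨v, hv'⟩, hv⟩, t, ?_⟩
  · rw [← comp_structMap f (Over.homMk (V'.ι ≫ h) (by simp [W, hh]) :
      Over.mk (V'.ι ≫ k ≫ U.hom) ⟶ W)]
    exact ht

end

/-! ### Fppf coverings, and torsors with an equivariant map to `M`. -/

section

variable {X : Scheme.{u}}

theorem isSheaf_forget (F : Sheaf (J X) AddCommGrpCat.{u + 1}) :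
    Presieve.IsSheaf (J X) (F.obj ⋙ forget AddCommGrpCat) :=
  (isSheaf_iff_isSheaf_of_type _ _).1
    ((Presheaf.isSheaf_iff_isSheaf_forget (J X) F.obj (forget AddCommGrpCat)).1 F.property)

theorem map_map_apply (F : Sheaf (J X) AddCommGrpCat.{u + 1}) {U V W : Over X} (i : V ⟶ U)
    (j : W ⟶ V) (s : F.obj.obj (op U)) :
    F.obj.map j.op (F.obj.map i.op s) = F.obj.map (j ≫ i).op s := by
  rw [op_comp, F.obj.map_comp]
  rfl

theorem hom_app_map {F G : Sheaf (J X) AddCommGrpCat.{u + 1}} (g : F ⟶ G) {U V : Over X}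
    (i : V ⟶ U) (s : F.obj.obj (op U)) :
    g.hom.app (op V) (F.obj.map i.op s) = G.obj.map i.op (g.hom.app (op U) s) :=
  congrArg (fun χ => χ s) (congrArg AddCommGrpCat.Hom.hom (g.hom.naturality i.op))

instance : Scheme.fppfPrecoverage.{u}.HasIsos where
  mem_coverings_of_isIso _ := Scheme.Hom.singleton_mem_fppfPrecoverage _

/-- An fppf covering sieve of `X` reaches each point of `X` by a flat morphism, locally of finite
presentation. -/
theorem exists_flat_of_mem {S : Sieve (Over.mk (𝟙 X))} (hS : S ∈ J X _) (x : X) :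
    ∃ (U : Over X) (k : U ⟶ Over.mk (𝟙 X)) (u : U.left), S k ∧ Flat U.hom ∧
      LocallyOfFinitePresentation U.hom ∧ U.hom u = x := by
  rw [GrothendieckTopology.mem_over_iff] at hS
  -- Fppf families are stable under composition, so a covering sieve contains one such family,
  -- without iteration.
  rw [Precoverage.mem_toGrothendieck_iff_of_isStableUnderComposition] at hS
  obtain ⟨P, hP, hPS⟩ := hS
  rw [Precoverage.mem_iff_exists_zeroHypercover] at hP
  obtain ⟨𝒰, rfl⟩ := hP
  obtain ⟨hsurj, hflat⟩ := (Scheme.ofArrows_mem_precoverage_iff _).1 𝒰.mem₀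
  obtain ⟨i, u, hu⟩ := hsurj x
  have h1 := (Sieve.overEquiv_iff S (𝒰.f i)).1 (hPS _ _ (Presieve.ofArrows.mk i))
  have h2 : Flat (𝒰.f i) ∧ LocallyOfFinitePresentation (𝒰.f i) := hflat i
  have e : 𝒰.f i ≫ 𝟙 X = 𝒰.f i := Category.comp_id _
  refine ⟨_, _, u, h1, ?_, ?_, ?_⟩
  · change Flat (𝒰.f i ≫ 𝟙 X)
    rw [e]; exact h2.1
  · change LocallyOfFinitePresentation (𝒰.f i ≫ 𝟙 X)
    rw [e]; exact h2.2
  · change (𝒰.f i ≫ 𝟙 X) u = x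
    rw [e]; exact hu

/-- A jointly surjective family of flat morphisms, locally of finite presentation, is an fppf
covering. -/
theorem ofArrows_mem {T : Type u} (V : T → Over X) (k : ∀ t, V t ⟶ Over.mk (𝟙 X))
    (h₁ : ∀ t, Flat (V t).hom) (h₂ : ∀ t, LocallyOfFinitePresentation (V t).hom)
    (h₃ : ∀ x : X, ∃ t, x ∈ Set.range (V t).hom) : Sieve.ofArrows V k ∈ J X _ := by
  have e : ∀ t, (k t).left = (V t).hom := fun t => by simpa using Over.w (k t)
  rw [GrothendieckTopology.mem_over_iff, Sieve.overEquiv_ofArrows]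
  refine Precoverage.generate_mem_toGrothendieck ?_
  refine (Scheme.ofArrows_mem_precoverage_iff _).2 ⟨fun x => ?_, fun t => ?_⟩
  · obtain ⟨t, ht⟩ := h₃ x
    exact ⟨t, by rw [e]; exact ht⟩
  · rw [e]
    exact ⟨h₁ t, h₂ t⟩

/-- A torsor under `G`, realized inside the sheaf `I`, with an equivariant morphism to `M`:
`rel V e m` says that `e` is a point of the torsor over `V`, with image `m`. -/
structure TrivializedTorsor {G M : Sheaf (J X) AddCommGrpCat.{u + 1}} (α : G ⟶ M)
    {I : Sheaf (J X) AddCommGrpCat.{u + 1}} (ι : G ⟶ I) where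
  rel (V : Over X) : I.obj.obj (op V) → M.obj.obj (op V) → Prop
  rel_map : ∀ {V W : Over X} (k : W ⟶ V) {e m}, rel V e m →
    rel W (I.obj.map k.op e) (M.obj.map k.op m)
  sieve : Sieve (Over.mk (𝟙 X))
  sieve_mem : sieve ∈ J X (Over.mk (𝟙 X))
  exists_rel : ∀ {V : Over X} (k : V ⟶ Over.mk (𝟙 X)), sieve k → ∃ e m, rel V e m
  exists_sub : ∀ {V : Over X} {e m e' m'}, rel V e m → rel V e' m' →
    ∃ g, e - e' = ι.hom.app (op V) g ∧ m - m' = α.hom.app (op V) g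
  rel_sub : ∀ {V : Over X} {e m} g, rel V e m →
    rel V (e - ι.hom.app (op V) g) (m - α.hom.app (op V) g)

namespace TrivializedTorsor

variable {G M : Sheaf (J X) AddCommGrpCat.{u + 1}} {α : G ⟶ M}
  {I : Sheaf (J X) AddCommGrpCat.{u + 1}} {ι : G ⟶ I} (t : TrivializedTorsor α ι)

/-- Over an `X`-scheme on which `α` vanishes, the torsor has constant image in `M`. -/
theorem exists_image (Y : Over X) (hY : ∀ (V : Over X) (_ : V ⟶ Y) (g), α.hom.app (op V) g = 0) :
    ∃ s : M.obj.obj (op Y), ∀ (V : Over X) (k : V ⟶ Y) (e m), t.rel V e m →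
      m = M.obj.map k.op s := by
  let c : Y ⟶ Over.mk (𝟙 X) := Over.homMk Y.hom
  -- Two points differ by some `g` with `α g = 0`, so their images agree; this makes the local
  -- images compatible.
  have uniq : ∀ {V : Over X} (k : V ⟶ Y) {e m e' m'}, t.rel V e m → t.rel V e' m' → m = m' := by
    intro V k e m e' m' h h'
    obtain ⟨g, -, hg⟩ := t.exists_sub h h'
    rw [hY V k g] at hg
    exact sub_eq_zero.1 hg
  have hcov := (J X).pullback_stable c t.sieve_mem
  choose e m hem using fun (V : Over X) (k : V ⟶ Y) (hk : t.sieve.pullback c k) =>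
    t.exists_rel (k ≫ c) hk
  have hM := isSheaf_forget M _ hcov
  obtain ⟨s, hs, -⟩ := hM (fun V k hk => m V k hk) (by
    intro V₁ V₂ Z g₁ g₂ f₁ f₂ h₁ h₂ hcomp
    exact uniq (g₁ ≫ f₁) (t.rel_map g₁ (hem _ f₁ h₁)) (t.rel_map g₂ (hem _ f₂ h₂)))
  refine ⟨s, fun V k e' m' h => ?_⟩
  have hcov' := (J X).pullback_stable k hcov
  refine (isSheaf_forget M _ hcov').isSeparatedFor.ext fun Z z hz => ?_
  have h1 := hs (z ≫ k) hz
  exact (uniq (z ≫ k) (t.rel_map z h) (hem _ _ hz)).trans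
    (h1.symm.trans (map_map_apply M k z s).symm)

/-- Points with trivial image on a covering, unique on products, glue. -/
theorem exists_glue {T : Type u} (V : T → Over X) (h₁ : ∀ t, Flat (V t).hom)
    (h₂ : ∀ t, LocallyOfFinitePresentation (V t).hom)
    (h₃ : ∀ x : X, ∃ t, x ∈ Set.range (V t).hom)
    (hinj : ∀ (W : Over X), Flat W.hom → Function.Injective (α.hom.app (op W)))
    (he : ∀ i, ∃ e, t.rel (V i) e 0) :
    ∃ e : I.obj.obj (op (Over.mk (𝟙 X))), ∃ S ∈ J X (Over.mk (𝟙 X)), ∀ (W : Over X)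
      (k : W ⟶ Over.mk (𝟙 X)), S k → ∃ m, t.rel W (I.obj.map k.op e) m := by
  choose e he using he
  let k : ∀ i, V i ⟶ Over.mk (𝟙 X) := fun i => Over.homMk (V i).hom
  have hcov := ofArrows_mem V k h₁ h₂ h₃
  have hI : Presieve.IsSheafFor (I.obj ⋙ forget AddCommGrpCat) (Presieve.ofArrows V k) :=
    (Presieve.isSheafFor_iff_generate _).2 (isSheaf_forget I _ hcov)
  obtain ⟨s, hs, -⟩ := (Presieve.isSheafFor_arrows_iff _ _).1 hI e (by
    intro i j Z gi gj _
    -- The given `Z` need not be flat over `X`, so `hinj` cannot be used on it. The comparison is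
    -- made on the fibre product `P`, which is flat, and pulled back to `Z`.
    let P : Over X := Over.mk (Limits.pullback.fst (V i).hom (V j).hom ≫ (V i).hom)
    let p₁ : P ⟶ V i := Over.homMk (Limits.pullback.fst _ _)
    let p₂ : P ⟶ V j := Over.homMk (Limits.pullback.snd _ _) Limits.pullback.condition.symm
    let z : Z ⟶ P := Over.homMk (Limits.pullback.lift gi.left gj.left ((Over.w gi).trans (Over.w gj).symm))
      ((Limits.pullback.lift_fst_assoc _ _ _ _).trans (Over.w gi))
    have z₁ : z ≫ p₁ = gi := Over.OverMorphism.ext (Limits.pullback.lift_fst _ _ _)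
    have z₂ : z ≫ p₂ = gj := Over.OverMorphism.ext (Limits.pullback.lift_snd _ _ _)
    have := h₁ i
    have := h₁ j
    have hP : Flat P.hom :=
      inferInstanceAs (Flat (Limits.pullback.fst (V i).hom (V j).hom ≫ (V i).hom))
    have key : I.obj.map p₁.op (e i) = I.obj.map p₂.op (e j) := by
      obtain ⟨g, hg, hg'⟩ := t.exists_sub (t.rel_map p₁ (he i)) (t.rel_map p₂ (he j))
      rw [map_zero, map_zero, sub_zero, ← map_zero (α.hom.app (op P)).hom] at hg'
      rw [← hinj P hP hg', map_zero] at hg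
      exact sub_eq_zero.1 hg
    have := congrArg (I.obj.map z.op) key
    rw [map_map_apply, map_map_apply, z₁, z₂] at this
    exact this)
  -- `rel` is not required to be local, so the glued section is related to an image only over the
  -- covering sieve.
  refine ⟨s, _, hcov, ?_⟩
  rintro W _ ⟨_, a, _, ⟨i⟩, rfl⟩
  refine ⟨M.obj.map a.op 0, ?_⟩
  rw [← map_map_apply, show I.obj.map (k i).op s = e i from hs i]
  exact t.rel_map a (he i)

end TrivializedTorsor

end

/-! ### From extensions of sheaves to torsors, and injectivity on `H¹`. -/

section

variable {X : Scheme.{u}} {G M : Sheaf (J X) AddCommGrpCat.{u + 1}} {α : G ⟶ M}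

/-- The torsor of the lifts of `q` along the extension `0 ⟶ G ⟶ I ⟶ Q ⟶ 0`, trivialized over `M`
by a lift `w` of the image of `q`. -/
noncomputable def TrivializedTorsor.ofExtension {I Q K P : Sheaf (J X) AddCommGrpCat.{u + 1}}
    {ι : G ⟶ I} {π : I ⟶ Q} {κ : M ⟶ K} {ρ : K ⟶ P} {φ : I ⟶ K} {ψ : Q ⟶ P}
    {h₁ : ι ≫ π = 0} {h₂ : κ ≫ ρ = 0} (hS : (ShortComplex.mk ι π h₁).ShortExact)
    (hT : (ShortComplex.mk κ ρ h₂).ShortExact) (c₁ : ι ≫ φ = α ≫ κ) (c₂ : φ ≫ ρ = π ≫ ψ)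
    (q : Q.obj.obj (op (Over.mk (𝟙 X)))) (w : K.obj.obj (op (Over.mk (𝟙 X))))
    (hw : ρ.hom.app _ w = ψ.hom.app _ q) : TrivializedTorsor α ι :=
  have e₀ : ∀ V g, π.hom.app (op V) (ι.hom.app (op V) g) = 0 := fun V g =>
    congrArg (fun χ : G ⟶ Q => χ.hom.app (op V) g) h₁
  have e₁ : ∀ V g, φ.hom.app (op V) (ι.hom.app (op V) g) = κ.hom.app (op V) (α.hom.app (op V) g) :=
    fun V g => congrArg (fun χ : G ⟶ K => χ.hom.app (op V) g) c₁
  have e₂ : ∀ V e, ρ.hom.app (op V) (φ.hom.app (op V) e) = ψ.hom.app (op V) (π.hom.app (op V) e) :=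
    fun V g => congrArg (fun χ : I ⟶ P => χ.hom.app (op V) g) c₂
  have uniq : ∀ {V : Over X} (k : V ⟶ Over.mk (𝟙 X)), k = Over.mkIdTerminal.from V :=
    fun _ => Over.mkIdTerminal.hom_ext _ _
  -- For a lift `e` of `q`, both `φ e` and `w` map to `ψ q` under `ρ`, so their difference comes
  -- from a unique section of `M`.
  { rel := fun V e m => π.hom.app (op V) e = Q.obj.map (Over.mkIdTerminal.from V).op q ∧
      φ.hom.app (op V) e - K.obj.map (Over.mkIdTerminal.from V).op w = κ.hom.app (op V) m
    rel_map := fun {V W} k {e m} h => by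
      rw [← uniq (k ≫ Over.mkIdTerminal.from V), hom_app_map, hom_app_map, hom_app_map,
        ← map_map_apply, ← map_map_apply, h.1, ← h.2, map_sub]
      exact ⟨rfl, rfl⟩
    sieve := Presheaf.imageSieve π.hom q
    sieve_mem :=
      have := hS.epi_g
      imageSieve_mem_of_epi π q
    exists_rel := fun {V} k hk => by
      obtain ⟨e, he⟩ := hk
      obtain ⟨m, hm⟩ := exists_section_of_exact hT V (φ.hom.app (op V) e - K.obj.map k.op w) (by
        change ρ.hom.app (op V) _ = 0
        rw [map_sub, e₂, he, hom_app_map, hom_app_map, hw, sub_self])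
      obtain rfl := uniq k
      exact ⟨e, m, he, hm.symm⟩
    exists_sub := fun {V e m e' m'} h h' => by
      obtain ⟨g, hg⟩ := exists_section_of_exact hS V (e - e') (by
        change π.hom.app (op V) _ = 0
        rw [map_sub, h.1, h'.1, sub_self])
      have := hT.mono_f
      refine ⟨g, hg.symm, injective_app_of_mono κ V ?_⟩
      rw [← e₁, show ι.hom.app (op V) g = e - e' from hg, map_sub, map_sub, ← h.2, ← h'.2]
      abel
    rel_sub := fun {V e m} g h => by
      rw [map_sub, map_sub, map_sub, e₀, e₁, h.1, ← h.2, sub_zero]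
      exact ⟨rfl, by abel⟩ }

/-- The homomorphisms from the constant sheaf `ℤ` are the global sections. -/
noncomputable def constantHomEquiv (F : Sheaf (J X) AddCommGrpCat.{u + 1}) :
    ((constantSheaf (J X) AddCommGrpCat.{u + 1}).obj (AddCommGrpCat.of (ULift ℤ)) ⟶ F) ≃+
      F.obj.obj (op (Over.mk (𝟙 X))) :=
  ((constantSheafAdj (J X) AddCommGrpCat.{u + 1} Over.mkIdTerminal).homAddEquiv _ F).trans
    (AddCommGrpCat.uliftZMultiplesAddEquiv _)

theorem constantHomEquiv_comp {F F' : Sheaf (J X) AddCommGrpCat.{u + 1}} (g : F ⟶ F')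
    (z : (constantSheaf (J X) AddCommGrpCat.{u + 1}).obj (AddCommGrpCat.of (ULift ℤ)) ⟶ F) :
    constantHomEquiv F' (z ≫ g) = g.hom.app _ (constantHomEquiv F z) := rfl

/-- If the torsors under `G` trivialized over `M` are trivial, then `H¹(G) → H¹(M)` is injective. -/
theorem functorH_map_injective
    (H : ∀ (I : Sheaf (J X) AddCommGrpCat.{u + 1}) (ι : G ⟶ I) (t : TrivializedTorsor α ι),
      ∃ e : I.obj.obj (op (Over.mk (𝟙 X))), ∃ S ∈ J X (Over.mk (𝟙 X)), ∀ (W : Over X)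
        (k : W ⟶ Over.mk (𝟙 X)), S k → ∃ m, t.rel W (I.obj.map k.op e) m) :
    Function.Injective ((Sheaf.functorH.{u + 1, u + 1, u, u + 1} (J X) 1).map α) := by
  refine (injective_iff_map_eq_zero ((Sheaf.functorH.{u + 1, u + 1, u, u + 1} (J X) 1).map α).hom).2 fun x hx => ?_
  refine ext_eq_zero_of_comp_mk₀_eq_zero α ?_ x hx
  intro I Q K P ι π κ ρ φ ψ h₁ h₂ hS hT c₁ c₂ q w hqw
  have hw := (constantHomEquiv_comp ρ w).symm.trans
    ((congrArg _ hqw).trans (constantHomEquiv_comp ψ q))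
  obtain ⟨e, S, hSm, he⟩ := H I ι (.ofExtension hS hT c₁ c₂ _ _ hw)
  refine ⟨(constantHomEquiv I).symm e, (constantHomEquiv Q).injective ?_⟩
  rw [constantHomEquiv_comp, AddEquiv.apply_symm_apply]
  -- That `e` lifts `q` is an equality of sections of `Q`, so it may be checked on the covering
  -- sieve.
  refine (isSheaf_forget Q S hSm).isSeparatedFor.ext fun W k hk => ?_
  obtain ⟨m, hm, -⟩ := he W k hk
  obtain rfl := Over.mkIdTerminal.hom_ext k (Over.mkIdTerminal.from W)
  exact (hom_app_map π _ e).symm.trans hm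

end

/-! ### The sheaves `G_{a,n}` and the filtration. -/

theorem admissible_pow_iff {R : Type*} [CommRing R] [IsDomain R]
    [IsDiscreteValuationRing R] {p n : ℕ} {π : R} (hπ : Irreducible π) (i : ℕ) :
    Admissible p n (π ^ i) ↔
      ((p ^ (n - 1) * (p - 1) * i : ℕ) : ℕ∞) ≤ IsDiscreteValuationRing.addVal R (p : R) := by
  rw [Admissible, IsDiscreteValuationRing.addVal_pow, IsDiscreteValuationRing.addVal_uniformizer hπ]
  simp [mul_assoc]

section

variable {R : Type u} [CommRing R] [IsDomain R] [IsDiscreteValuationRing R] [CharZero R] {p n : ℕ}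
  [Fact p.Prime] {a : R}

theorem fppfH_map_alphaHom_injective (h : Admissible p n a) {X : Scheme.{u}} [IsNormalScheme X]
    (f : X ⟶ Spec (CommRingCat.of R)) [Flat f] :
    Function.Injective ((fppfH X 1).map (alphaHom h f)) := by
  refine functorH_map_injective
    (α := (sheafCompose (J X) AddCommGrpCat.uliftFunctor.{u + 1, u}).map (alphaHom h f)) ?_
  set α := (sheafCompose (J X) AddCommGrpCat.uliftFunctor.{u + 1, u}).map (alphaHom h f)
  -- `gval` and `mval` strip the universe lift and the additive notation: the zero section of `μ`
  -- has value `1`.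
  let gval : ∀ {V : Over X}, ((sheafCompose (J X) AddCommGrpCat.uliftFunctor.{u + 1, u}).obj
    (kerSheaf h f)).obj.obj (op V) → Γ(V.left, ⊤) := fun {V} g => (Additive.toMul g.down).1.val
  let mval : ∀ {V : Over X}, ((sheafCompose (J X) AddCommGrpCat.uliftFunctor.{u + 1, u}).obj
    (muSheaf X (p ^ n))).obj.obj (op V) → Γ(V.left, ⊤) := fun {V} m => (Additive.toMul m.down).1
  have mval_inj : ∀ {V : Over X}, Function.Injective (mval (V := V)) := fun {V} m m' hm =>
    ULift.ext _ _ (congrArg Additive.ofMul (Subtype.ext (Units.ext hm)))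
  have gval_inj : ∀ {V : Over X}, Function.Injective (gval (V := V)) := fun {V} m m' hm =>
    ULift.ext _ _ (congrArg Additive.ofMul (Subtype.ext (GPoint.ext hm)))
  have mval_alpha : ∀ {V : Over X} g, mval (α.hom.app (op V) g) = 1 + structMap f V a * gval g :=
    fun g => rfl
  have mval_pow : ∀ {V : Over X} (m), mval (V := V) m ^ p ^ n = 1 := fun m =>
    (mem_rootsOfUnity' _ _).1 (Additive.toMul m.down).2
  have flat_comp : ∀ {V : Over X}, Flat V.hom → Flat (V.hom ≫ f) := fun _ => inferInstance
  intro I ι t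
  have point : ∀ x : X, ∃ V : Over X, Flat V.hom ∧ LocallyOfFinitePresentation V.hom ∧
      x ∈ Set.range V.hom ∧ ∃ e, t.rel V e 0 := by
    intro x
    obtain ⟨U, k₀, u, hk₀, hU₁, hU₂, rfl⟩ := exists_flat_of_mem t.sieve_mem x
    obtain ⟨e, m, hem⟩ := t.exists_rel k₀ hk₀
    obtain ⟨V, k, hk, ⟨v, hv⟩, s, hs⟩ := exists_open_congr_one f h.ne_zero
      (pow_pos (Fact.out : p.Prime).pos n) (fun k h1 h2 => pow_sub_dvd_choose h h2.le h1) U u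
      (mval m) (mval_pow m) (by
        intro Y hY
        obtain ⟨s, hs⟩ := t.exists_image Y (by
          intro V k g
          refine mval_inj ?_
          rw [mval_alpha, ← comp_structMap f k, RingHom.comp_apply, hY, map_zero, zero_mul,
            add_zero]
          rfl)
        exact ⟨mval s, fun Z i j => congrArg mval (hs Z j _ _ (t.rel_map i hem))⟩)
    have hVU : V.hom = k.left ≫ U.hom := (Over.w k).symm
    have hV : Flat V.hom := by rw [hVU]; infer_instance
    have := flat_comp hV
    -- Here `a ^ q * P(s) = m ^ q - 1 = 0` with `q = p ^ n`, and `a ^ q` is regular because `V` is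
    -- flat over `R`.
    have hroot : (isogenyPoly a (p ^ n)).eval₂ (structMap f V) s = 0 := by
      have e1 := eval₂_isogenyPoly h (structMap f V) s
      rw [← hs, ← map_pow k.left.appTop.hom, mval_pow, map_one,
        sub_self] at e1
      exact isLeftRegular_iff_right_eq_zero_of_mul.1
        ((isLeftRegular_structMap f V h.ne_zero).pow _) _ e1
    refine ⟨V, hV, by rw [hVU]; infer_instance, ⟨v, by rw [hVU, ← hv]; rfl⟩, ?_⟩
    let g : ((sheafCompose (J X) AddCommGrpCat.uliftFunctor.{u + 1, u}).obj
        (kerSheaf h f)).obj.obj (op V) := ⟨Additive.ofMul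
      ⟨⟨s, isUnit_of_eval₂_eq_zero h _ _ hroot⟩, (mem_kerPoints_iff h _ _).2 hroot⟩⟩
    -- Since `m = α g` on `V`, translating the point by `g` makes its image trivial.
    have h2 := t.rel_sub g (t.rel_map k hem)
    have h3 : ((sheafCompose (J X) AddCommGrpCat.uliftFunctor.{u + 1, u}).obj
        (muSheaf X (p ^ n))).obj.map k.op m = α.hom.app (op V) g := mval_inj hs
    rw [h3, sub_self] at h2
    exact ⟨_, h2⟩
  choose V hV₁ hV₂ hV₃ hV₄ using point
  refine t.exists_glue V hV₁ hV₂ (fun x => ⟨x, hV₃ x⟩) (fun W hW g g' hgg' => gval_inj ?_) hV₄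
  have := flat_comp hW
  have e := congrArg mval hgg'
  rw [mval_alpha, mval_alpha] at e
  exact isLeftRegular_structMap f W h.ne_zero (add_left_cancel e)

theorem scaleHom_comp_alphaHom {b c : R} (ha : Admissible p n a) (hb : Admissible p n b)
    (hc : a = c * b) {X : Scheme.{u}} (f : X ⟶ Spec (CommRingCat.of R)) :
    scaleHom ha hb hc f ≫ alphaHom hb f = alphaHom ha f := by
  ext U x
  refine Subtype.ext (Units.ext ?_)
  change 1 + structMap f U.unop b * (structMap f U.unop c * (Additive.toMul x).1.val) =
    1 + structMap f U.unop a * (Additive.toMul x).1.val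
  have e : structMap f U.unop a = structMap f U.unop c * structMap f U.unop b := by
    rw [← map_mul, ← hc]
  linear_combination (-(Additive.toMul x).1.val) * e

theorem exists_isGreatest_admissible {π : R} (hπ : Irreducible π) :
    ∃ i₀, IsGreatest {i : ℕ | Admissible p n (π ^ i)} i₀ ∧ ∀ i ≤ i₀, Admissible p n (π ^ i) := by
  have hp : p.Prime := Fact.out
  have hpos : 0 < p ^ (n - 1) * (p - 1) :=
    Nat.mul_pos (pow_pos hp.pos _) (Nat.sub_pos_of_lt hp.one_lt)
  obtain ⟨v, hv⟩ : ∃ v : ℕ, IsDiscreteValuationRing.addVal R (p : R) = v := by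
    refine ENat.ne_top_iff_exists.1 ?_ |>.imp fun _ => Eq.symm
    rw [Ne, IsDiscreteValuationRing.addVal_eq_top_iff, Nat.cast_eq_zero]
    exact hp.ne_zero
  simp_rw [admissible_pow_iff hπ, hv, Nat.cast_le]
  -- The greatest index is the integral part of `v(p) / (p ^ (n - 1) * (p - 1))`; `v(p)` is finite
  -- because `p ≠ 0` in `R`.
  refine ⟨v / (p ^ (n - 1) * (p - 1)), ⟨Nat.mul_div_le _ _, fun i hi => ?_⟩, fun i hi => ?_⟩
  · exact (Nat.le_div_iff_mul_le hpos).2 ((mul_comm _ _).trans_le hi)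
  · exact (Nat.mul_le_mul_left _ hi).trans (Nat.mul_div_le _ _)

end

end FppfFiltration

theorem mainTheorem10 {R : Type u} [CommRing R] [IsDomain R] [IsDiscreteValuationRing R]
    [CharZero R] (p : ℕ) [Fact p.Prime] [CharP (IsLocalRing.ResidueField R) p]
    (π : R) (hπ : Irreducible π) (n : ℕ) (hn : 1 ≤ n)
    (X : Scheme.{u}) [IsIntegral X] [IsNormalScheme X]
    (f : X ⟶ Spec (CommRingCat.of R)) [Flat f] [Surjective f] :
    ∃ (i₀ : ℕ) (_ : IsGreatest {i : ℕ | Admissible p n (π ^ i)} i₀)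
      (h : ∀ i ≤ i₀, Admissible p n (π ^ i)),
      (∀ (i : ℕ) (hi : i ≤ i₀),
        Function.Injective ((fppfH X 1).map (alphaHom (h i hi) f))) ∧
      (∀ (i j : ℕ) (hji : j ≤ i) (hi : i ≤ i₀),
        Function.Injective ((fppfH X 1).map
          (scaleHom (h i hi) (h j (hji.trans hi)) (pow_sub_mul_pow π hji).symm f)) ∧
        (fppfH X 1).map
            (scaleHom (h i hi) (h j (hji.trans hi)) (pow_sub_mul_pow π hji).symm f) ≫
          (fppfH X 1).map (alphaHom (h j (hji.trans hi)) f) =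
            (fppfH X 1).map (alphaHom (h i hi) f) ∧
        ((fppfH X 1).map (alphaHom (h i hi) f)).hom.range ≤
          ((fppfH X 1).map (alphaHom (h j (hji.trans hi)) f)).hom.range) := by
  obtain ⟨i₀, hi₀, h⟩ := exists_isGreatest_admissible (p := p) (n := n) hπ
  refine ⟨i₀, hi₀, h, fun i hi => fppfH_map_alphaHom_injective (h i hi) f, fun i j hji hi => ?_⟩
  have comp : (fppfH X 1).map
      (scaleHom (h i hi) (h j (hji.trans hi)) (pow_sub_mul_pow π hji).symm f) ≫
        (fppfH X 1).map (alphaHom (h j (hji.trans hi)) f) =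
          (fppfH X 1).map (alphaHom (h i hi) f) := by
    rw [← Functor.map_comp, scaleHom_comp_alphaHom]
  refine ⟨?_, comp, ?_⟩
  · have inj := fppfH_map_alphaHom_injective (h i hi) f
    rw [← comp] at inj
    exact Function.Injective.of_comp (f := (fppfH X 1).map (alphaHom (h j (hji.trans hi)) f)) inj
  · rw [← comp]
    rintro _ ⟨x, rfl⟩
    exact ⟨_, rfl⟩
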